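/- Let $G=(V,E)$ be a finite connected undirected graph with $n\ge 3$ nodes and maximum degree $\Delta$. For $S\subseteq V$ let $\partial S$ be the set of nodes outside $S$ that have a neighbor in $S$, and let $$\alpha=\min_{1\le |S|\le \lceil n/2\rceil}\frac{|\partial S|}{|S|}$$ be the vertex expansion of $G$. Each node $u$ starts with a finite (possibly empty) set $T_u$ of tokens; let $\mathcal T=\bigcup_u T_u$ and $k=|\mathcal T|$. **Synchronous random diffusion gossip** in the mobile telephone model proceeds in rounds. A hash function $H$ on finite token sets is drawn from some distribution (possibly a point mass) before the first round, and all nodes use it. At the beginning of a round every node $u$ advertises to its neighbors the hash $H(S_u)$ and the size $|S_u|$ of its current token set $S_u$. Then every node $u$, independently of the others, proposes a connection to a uniformly random node among those of its neighbors that have the smallest advertised size among the neighbors whose advertised hash differs from $H(S_u)$; if no neighbor has a different hash, $u$ sends no proposal. A node that receives at least one proposal accepts exactly one of them (it may in the same round have its own proposal accepted). Over each resulting connection each of the two endpoints $x$ receives from the other one $y$ one token of $S_y\setminus S_x$, if that set is non-empty; the sets are those at the beginning of the round. Which proposal a node accepts and which missing token is sent are arbitrary: they may be random and may depend on the whole past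 of token sets and proposals and on the current proposals, but this rule depends on the hash function only through the token sets and proposals. **Theorem.** For every $c>0$ there is a constant $C>0$, depending only on $c$, such that the following holds for all $G$, all initial token sets, all rules as above for acceptance and token choice, and all hash distributions in which any two distinct subsets $A\neq B$ of $\mathcal T$ collide with probability $$\Pr[H(A)=H(B)]\le \frac{n^{-c}}{(n(k+1))^{2}}$$ (in particular, for every hash function without collisions on subsets of $\mathcal T$). For every integer $r\ge 0$ with $$r\ \ge\ C\cdot\frac{k}{\alpha}\cdot\log n\cdot\log^2\Delta ,$$ with probability at least $1-n^{-c}$ every node has all $k$ tokens after $r$ rounds. (In particular, for $k=1$, a rumor spreads to all nodes in $O((1/\alpha)\log n\log^2\Delta)$ rounds with high probability.) -/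

import Mathlib

namespace MobileTelephone

/-- The boundary of `S`: the nodes outside `S` that have a neighbor in `S`. -/
noncomputable def boundary {V : Type*} [Fintype V] (G : SimpleGraph V) (S : Finset V) :
    Finset V := by
  classical
  exact Finset.univ.filter fun v => v ∉ S ∧ ∃ u ∈ S, G.Adj u v

/-- The vertex expansion: the minimum of `|∂S| / |S|` over the node sets `S` with
`1 ≤ |S| ≤ ⌈n / 2⌉`, where `n` is the number of nodes; `(n + 1) / 2` is `⌈n / 2⌉`.
The infimum is over a finite set, which is nonempty as soon as there is a node. -/
noncomputable def vertexExpansion {V : Type*} [Fintype V] (G : SimpleGraph V) : ℝ :=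
  ⨅ S : {S : Finset V // 1 ≤ S.card ∧ S.card ≤ (Fintype.card V + 1) / 2},
    ((boundary G S.1).card : ℝ) / (S.1.card : ℝ)

/-- A state of the network: the token set of each node. -/
abbrev TokenState (V τ : Type*) := V → Finset τ

/-- The proposals of one round: the neighbor to which each node proposes, if any. -/
abbrev Proposals (V : Type*) := V → Option V

/-- The completed rounds, latest first: for each of them the state at its beginning and the
proposals that were made in it. -/
abbrev History (V τ : Type*) := List (TokenState V τ × Proposals V)

/-- What a node advertises: the hash of its token set and the size of its token set. -/
def advertisement {V τ β : Type*} (H : Finset τ → β) (S : TokenState V τ) (u : V) : β × ℕ :=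
  (H (S u), (S u).card)

/-- The neighbors among which `u` picks the recipient of its proposal: those whose advertised
hash differs from that of `u` and whose advertised size is the smallest among these. -/
noncomputable def candidates {V τ β : Type*} [Fintype V] (G : SimpleGraph V)
    (H : Finset τ → β) (S : TokenState V τ) (u : V) : Finset V := by
  classical
  exact Finset.univ.filter fun v =>
    (G.Adj u v ∧ (advertisement H S v).1 ≠ (advertisement H S u).1) ∧
      ∀ w, G.Adj u w → (advertisement H S w).1 ≠ (advertisement H S u).1 →
        (advertisement H S v).2 ≤ (advertisement H S w).2

/-- The possible proposals of `u`: to any of its candidates, or none if there are none. -/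
noncomputable def choices {V τ β : Type*} [Fintype V] (G : SimpleGraph V)
    (H : Finset τ → β) (S : TokenState V τ) (u : V) : Finset (Option V) := by
  classical
  exact if candidates G H S u = ∅ then {none}
    else (candidates G H S u).map Function.Embedding.some

theorem choices_nonempty {V τ β : Type*} [Fintype V] (G : SimpleGraph V)
    (H : Finset τ → β) (S : TokenState V τ) (u : V) : (choices G H S u).Nonempty := by
  unfold choices
  split_ifs with h
  · exact Finset.singleton_nonempty _
  · exact (Finset.map_nonempty).2 (Finset.nonempty_iff_ne_empty.2 h)

/-- The combinations of one possible proposal for each node. -/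
noncomputable def jointChoices {V τ β : Type*} [Fintype V] (G : SimpleGraph V)
    (H : Finset τ → β) (S : TokenState V τ) : Finset (Proposals V) := by
  classical
  exact Fintype.piFinset fun u => choices G H S u

theorem jointChoices_nonempty {V τ β : Type*} [Fintype V] (G : SimpleGraph V)
    (H : Finset τ → β) (S : TokenState V τ) : (jointChoices G H S).Nonempty := by
  classical
  unfold jointChoices
  exact Fintype.piFinset_nonempty.2 fun u => choices_nonempty G H S u

/-- The nodes make their choices uniformly and independently of each other, so that the joint
distribution is uniform on the product of the sets of choices. -/
noncomputable def proposalDist {V τ β : Type*} [Fintype V] (G : SimpleGraph V)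
    (H : Finset τ → β) (S : TokenState V τ) : PMF (Proposals V) :=
  PMF.uniformOfFinset (jointChoices G H S) (jointChoices_nonempty G H S)

/-- `acc` describes an admissible acceptance of the proposals `p`, where `acc v = some u` means
that `v` accepts the proposal of `u`: every node accepts at most one proposal, only proposals
that were sent to it, and at least one if it received any. -/
def IsAcceptance {V : Type*} (p acc : Proposals V) : Prop :=
  (∀ u v, acc v = some u → p u = some v) ∧ (∀ u v, p u = some v → acc v ≠ none)

/-- `X` is what is sent over a connection from a node with token set `A` to a node with token
set `B`: one token of `A \ B`, or nothing if `A \ B` is empty. -/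
def IsTransfer {τ : Type*} (A B X : Finset τ) : Prop :=
  (∀ x ∈ X, x ∈ A ∧ x ∉ B) ∧ X.card ≤ 1 ∧ (¬ A ⊆ B → X.Nonempty)

/-- `S'` is a possible state after a round that starts in state `S` and has proposals `p`.
Over each connection, made by the proposal of `u` and accepted by `v`, the proposer `u` sends
`fwd u v` to `v`, and `v` sends `bwd u v` to `u`. -/
def IsRoundOutcome {V τ : Type*} (S : TokenState V τ) (p : Proposals V)
    (S' : TokenState V τ) : Prop :=
  ∃ (acc : Proposals V) (fwd bwd : V → V → Finset τ),
    IsAcceptance p acc ∧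
    (∀ u v, acc v = some u → IsTransfer (S u) (S v) (fwd u v) ∧
      IsTransfer (S v) (S u) (bwd u v)) ∧
    ∀ w x, x ∈ S' w ↔
      x ∈ S w ∨ (∃ u, acc w = some u ∧ x ∈ fwd u w) ∨ (∃ v, acc v = some w ∧ x ∈ bwd w v)

/-- How the model resolves what the algorithm leaves open in a round: which of several proposals
a node accepts, and which missing token is sent. The resolution may be arbitrary, may be
randomized, and may depend on the whole past and on the proposals of the current round. -/
structure Resolution (V τ : Type*) where
  /-- the distribution of the next state, given past, current state and current proposals -/
  next : History V τ → TokenState V τ → Proposals V → PMF (TokenState V τ)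
  /-- only possible outcomes of a round occur -/
  isRoundOutcome : ∀ h S p, ∀ S' ∈ (next h S p).support, IsRoundOutcome S p S'

/-- One round of synchronous random diffusion gossip. -/
noncomputable def gossipRound {V τ β : Type*} [Fintype V] (G : SimpleGraph V)
    (H : Finset τ → β) (R : Resolution V τ) (e : History V τ × TokenState V τ) :
    PMF (History V τ × TokenState V τ) :=
  (proposalDist G H e.2).bind fun p =>
    (R.next e.1 e.2 p).map fun S' => ((e.2, p) :: e.1, S')

/-- The distribution of the execution after `r` rounds, from the initial state `T`, with hash
function `H`. -/
noncomputable def execution {V τ β : Type*} [Fintype V] (G : SimpleGraph V)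
    (H : Finset τ → β) (R : Resolution V τ) (T : TokenState V τ) :
    ℕ → PMF (History V τ × TokenState V τ)
  | 0 => PMF.pure ([], T)
  | r + 1 => (execution G H R T r).bind (gossipRound G H R)

/-- The distribution of the execution after `r` rounds when the hash function is drawn from
`hashDist` before the first round and then used by all nodes throughout. -/
noncomputable def randomDiffusionGossip {V τ β : Type*} [Fintype V] (G : SimpleGraph V)
    (hashDist : PMF (Finset τ → β)) (R : Resolution V τ) (T : TokenState V τ) (r : ℕ) :
    PMF (History V τ × TokenState V τ) :=
  hashDist.bind fun H => execution G H R T r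

/-- The set of all tokens that some node has in state `T`. -/
noncomputable def allTokens {V τ : Type*} [Fintype V] (T : TokenState V τ) : Finset τ := by
  classical
  exact Finset.univ.biUnion T

/-- In state `S` every node has all the tokens of the initial state `T`. -/
def GossipSolved {V τ : Type*} [Fintype V] (T S : TokenState V τ) : Prop :=
  ∀ v, allTokens T ⊆ S v

end MobileTelephone

/-!
The hash function is first replaced by the identity, under which advertisements of different token
sets differ. An execution in which the hash function `H` has separated all token sets that occurred
has the same probability under `H` as under the identity (`iterKernel_apply_eq_id`). Hence the
failure probability grows by at most the probability that a random `H`, independent of the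
execution under the identity, merges two of the at most `n (k + 1)` token sets of that execution;
the union bound over pairs costs half of the allowed `n ^ (-c)`
(`toOuterMeasure_randomDiffusionGossip_le`).

Without collisions, let `L` be the class of nodes with the minimal number `i` of tokens. A node of
`L` that receives a proposal learns a token and leaves `L`, and every node outside `L` with
neighbors in `L` proposes to a uniformly random one of them. A maximal matching of a set `U` outside
`L` into `L` has size at least `α / 3` times the smaller side of the cut
(`exists_isCutMatching`). Consider a node `u` of `U` with `d` neighbors in `L`. Either the other
nodes hit at least half of these, and then `d` is halved, or with probability at least one half `u`
picks a target that nobody else picks, and then a node of `L` of its own leaves `L`. As `d` can be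
halved only about `log₂ Δ` times, a potential that adds the number of nodes yet to leave `L` to half
the total binary length of the degrees `d` drops by `3 / 8 * |U|` per round in expectation, as long
as fewer than `|U| / 4` nodes have left (`phasePotential_drift`). So a phase of `O(log Δ)` rounds
succeeds in removing `|U| / 4` nodes from `L` with probability at least one half, whatever happened
before (`expect_unfinished_le`).

With `aᵢ` the number of nodes that have at most `i` tokens, a successful phase raises the sum of
`log (n - aᵢ + 1) - log (aᵢ + 1)` over `i < k` by a constant times `α`, no round lowers it, and it
stays within `± k log (n + 1)`. The exponential of what is missing, measured in units of `α`,
therefore shrinks by the factor `3 / 4` in expectation per phase (`expect_globalPotential_le`), so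
that `O((k / α) log n)` phases suffice with high probability.
-/

namespace MobileTelephone

open scoped ENNReal

/-! ### Expectations and iterated kernels of discrete distributions -/

/-- The expectation of a nonnegative function under a discrete distribution. -/
noncomputable def expect {X : Type*} (μ : PMF X) (f : X → ℝ≥0∞) : ℝ≥0∞ :=
  ∑' x, μ x * f x

section Expect

variable {X Y : Type*}

theorem expect_mono {μ : PMF X} {f g : X → ℝ≥0∞} (h : ∀ x ∈ μ.support, f x ≤ g x) :
    expect μ f ≤ expect μ g := by
  refine ENNReal.tsum_le_tsum fun x => ?_
  by_cases hx : μ x = 0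
  · simp [hx]
  · gcongr
    exact h x ((PMF.mem_support_iff _ _).2 hx)

theorem expect_pure (x : X) (f : X → ℝ≥0∞) : expect (PMF.pure x) f = f x := by
  classical
  unfold expect
  rw [tsum_eq_single x]
  · simp
  · intro y hy
    simp [PMF.pure_apply, hy]

theorem expect_bind (μ : PMF X) (K : X → PMF Y) (f : Y → ℝ≥0∞) :
    expect (μ.bind K) f = expect μ fun x => expect (K x) f := by
  simp only [expect, PMF.bind_apply, ← ENNReal.tsum_mul_right, ← ENNReal.tsum_mul_left]
  rw [ENNReal.tsum_comm]
  simp only [mul_assoc]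

theorem expect_map (μ : PMF X) (φ : X → Y) (f : Y → ℝ≥0∞) :
    expect (μ.map φ) f = expect μ fun x => f (φ x) := by
  rw [PMF.map, expect_bind]
  simp [expect_pure]

theorem expect_const (μ : PMF X) (a : ℝ≥0∞) : expect μ (fun _ => a) = a := by
  simp [expect, ENNReal.tsum_mul_right]

theorem expect_add (μ : PMF X) (f g : X → ℝ≥0∞) :
    expect μ (fun x => f x + g x) = expect μ f + expect μ g := by
  simp [expect, mul_add, ENNReal.tsum_add]

theorem expect_const_mul (μ : PMF X) (a : ℝ≥0∞) (f : X → ℝ≥0∞) :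
    expect μ (fun x => a * f x) = a * expect μ f := by
  simp only [expect, ← ENNReal.tsum_mul_left]
  exact tsum_congr fun x => by ring

theorem expect_le_of_support {μ : PMF X} {f : X → ℝ≥0∞} {a : ℝ≥0∞}
    (h : ∀ x ∈ μ.support, f x ≤ a) : expect μ f ≤ a :=
  (expect_mono h).trans (expect_const μ a).le

theorem toOuterMeasure_eq_expect (μ : PMF X) (A : Set X) :
    μ.toOuterMeasure A = expect μ (A.indicator 1) := by
  rw [PMF.toOuterMeasure_apply]
  refine tsum_congr fun x => ?_
  by_cases hx : x ∈ A <;> simp [hx]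

theorem expect_uniformOfFinset (s : Finset X) (hs : s.Nonempty) (f : X → ℝ≥0∞) :
    expect (PMF.uniformOfFinset s hs) f = (s.card : ℝ≥0∞)⁻¹ * ∑ x ∈ s, f x := by
  classical
  unfold expect
  rw [tsum_eq_sum (s := s)]
  · rw [Finset.mul_sum]
    refine Finset.sum_congr rfl fun x hx => ?_
    rw [PMF.uniformOfFinset_apply_of_mem hs hx]
  · intro x hx
    rw [PMF.uniformOfFinset_apply_of_notMem hs hx, zero_mul]

/-- The distribution after `r` steps of the Markov chain with transition kernel `K`. -/
noncomputable def iterKernel (K : X → PMF X) : ℕ → X → PMF X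
  | 0 => PMF.pure
  | r + 1 => fun x => (iterKernel K r x).bind K

theorem iterKernel_add (K : X → PMF X) (a b : ℕ) (x : X) :
    iterKernel K (a + b) x = (iterKernel K a x).bind (iterKernel K b) := by
  induction b with
  | zero => simp [iterKernel]
  | succ b ih =>
    rw [← add_assoc]
    simp only [iterKernel]
    rw [ih, PMF.bind_bind]

/-- A transitive reflexive relation that holds along each step holds along every trajectory. -/
theorem iterKernel_support_rel {K : X → PMF X} {Q : X → X → Prop} (hrefl : ∀ x, Q x x)
    (htrans : ∀ x y z, Q x y → Q y z → Q x z) (hstep : ∀ x, ∀ y ∈ (K x).support, Q x y)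
    (r : ℕ) (x : X) : ∀ y ∈ (iterKernel K r x).support, Q x y := by
  induction r with
  | zero =>
    intro y hy
    simp only [iterKernel, PMF.support_pure, Set.mem_singleton_iff] at hy
    exact hy ▸ hrefl x
  | succ r ih =>
    intro y hy
    simp only [iterKernel, PMF.mem_support_bind_iff] at hy
    obtain ⟨z, hz, hy⟩ := hy
    exact htrans _ _ _ (ih z hz) (hstep z y hy)

/-- A Foster–Lyapunov bound: if the potential `Ψ` decreases by `ε` in expectation in each step
made from `N`, and `N` is never re-entered, then the chain is unlikely to stay in `N` for long. -/
theorem iterKernel_drift {K : X → PMF X} {I : X → Prop} {N : Set X} {Ψ : X → ℝ≥0∞} {ε : ℝ≥0∞}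
    (hI : ∀ x, I x → ∀ y ∈ (K x).support, I y)
    (hN : ∀ x, I x → ∀ y ∈ (K x).support, y ∈ N → x ∈ N)
    (hdrift : ∀ x, I x → x ∈ N → expect (K x) Ψ + ε ≤ Ψ x)
    (hzero : ∀ x, I x → x ∉ N → Ψ x = 0) (x : X) (hx : I x) (t : ℕ) :
    t * ε * expect (iterKernel K t x) (N.indicator 1) ≤ Ψ x := by
  have hreach : ∀ s, ∀ y ∈ (iterKernel K s x).support, I y := by
    intro s
    induction s with
    | zero =>
      intro y hy
      simp only [iterKernel, PMF.support_pure, Set.mem_singleton_iff] at hy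
      exact hy ▸ hx
    | succ s ih =>
      intro y hy
      simp only [iterKernel, PMF.mem_support_bind_iff] at hy
      obtain ⟨z, hz, hy⟩ := hy
      exact hI z (ih z hz) y hy
  have key : expect (iterKernel K t x) Ψ
      + t * ε * expect (iterKernel K t x) (N.indicator 1) ≤ Ψ x := by
    induction t with
    | zero => simp [iterKernel, expect_pure]
    | succ t ih =>
      refine le_trans ?_ ih
      have h1 : expect (iterKernel K (t + 1) x) Ψ
          + ε * expect (iterKernel K t x) (N.indicator 1) ≤ expect (iterKernel K t x) Ψ := by
        simp only [iterKernel]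
        rw [expect_bind, ← expect_const_mul, ← expect_add]
        refine expect_mono fun y hy => ?_
        have hIy := hreach t y hy
        by_cases hyN : y ∈ N
        · simpa [hyN] using hdrift y hIy hyN
        · simp only [hyN, not_false_eq_true, Set.indicator_of_notMem, mul_zero, add_zero]
          refine expect_le_of_support fun z hz => ?_
          rw [hzero z (hI y hIy z hz) fun hzN => hyN (hN y hIy z hz hzN)]
          exact zero_le
      have h2 : expect (iterKernel K (t + 1) x) (N.indicator 1)
          ≤ expect (iterKernel K t x) (N.indicator 1) := by
        simp only [iterKernel]
        rw [expect_bind]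
        refine expect_mono fun y hy => expect_le_of_support fun z hz => ?_
        by_cases hzN : z ∈ N
        · simp [hzN, hN y (hreach t y hy) z hz hzN]
        · simp [hzN]
      calc _ ≤ expect (iterKernel K (t + 1) x) Ψ
            + (t + 1 : ℕ) * ε * expect (iterKernel K t x) (N.indicator 1) := by gcongr
        _ = (expect (iterKernel K (t + 1) x) Ψ + ε * expect (iterKernel K t x) (N.indicator 1))
            + t * ε * expect (iterKernel K t x) (N.indicator 1) := by push_cast; ring
        _ ≤ _ := by gcongr
  exact le_trans le_add_self key

end Expect

/-! ### Vertex expansion and matchings across a cut -/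

section Cut

variable {V : Type*} [Fintype V] {G : SimpleGraph V}

theorem mem_boundary {S : Finset V} {v : V} :
    v ∈ boundary G S ↔ v ∉ S ∧ ∃ u ∈ S, G.Adj u v := by
  simp [boundary]

theorem vertexExpansion_mul_card_le {S : Finset V} (hS : S.card ≤ (Fintype.card V + 1) / 2) :
    vertexExpansion G * S.card ≤ (boundary G S).card := by
  rcases S.eq_empty_or_nonempty with rfl | hne
  · simp
  have hpos := Finset.card_pos.2 hne
  have h : vertexExpansion G ≤ ((boundary G S).card : ℝ) / (S.card : ℝ) := by
    unfold vertexExpansion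
    exact ciInf_le (Set.finite_range _).bddBelow
      (⟨S, hpos, hS⟩ : {S : Finset V // 1 ≤ S.card ∧ S.card ≤ (Fintype.card V + 1) / 2})
  exact (le_div_iff₀ (by exact_mod_cast hpos)).1 h

theorem vertexExpansion_le_one (hV : 1 ≤ Fintype.card V) : vertexExpansion G ≤ 1 := by
  classical
  obtain ⟨S, -, hS⟩ := Finset.exists_subset_card_eq
    (s := (Finset.univ : Finset V)) (n := (Fintype.card V + 1) / 2)
    (by rw [Finset.card_univ]; omega)
  have h := vertexExpansion_mul_card_le (G := G) hS.le
  have hb : (boundary G S).card ≤ S.card := by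
    have : boundary G S ⊆ Sᶜ := fun v hv => by simpa using (mem_boundary.1 hv).1
    have := Finset.card_le_card this
    rw [Finset.card_compl] at this
    omega
  have hpos : (0 : ℝ) < S.card := by exact_mod_cast (by omega : 0 < S.card)
  have hb' : ((boundary G S).card : ℝ) ≤ S.card := by exact_mod_cast hb
  by_contra hlt
  push Not at hlt
  nlinarith

theorem exists_adj_notMem_of_connected (hG : G.Connected) {S : Finset V} (hne : S.Nonempty)
    (hlt : S.card < Fintype.card V) : ∃ u ∈ S, ∃ v ∉ S, G.Adj u v := by
  classical
  obtain ⟨a, ha⟩ := hne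
  obtain ⟨b, hb⟩ : ∃ b, b ∉ S := by
    by_contra h
    push Not at h
    rw [Finset.eq_univ_iff_forall.2 h, Finset.card_univ] at hlt
    exact lt_irrefl _ hlt
  by_contra hcon
  push Not at hcon
  refine hb ?_
  obtain ⟨w⟩ := hG.preconnected a b
  clear hb
  induction w with
  | nil => exact ha
  | cons hadj _ ih =>
    refine ih ?_
    by_contra hn
    exact hcon _ ha _ hn hadj

theorem vertexExpansion_pos (hG : G.Connected) (hV : 2 ≤ Fintype.card V) :
    0 < vertexExpansion G := by
  classical
  have hne : Nonempty {S : Finset V // 1 ≤ S.card ∧ S.card ≤ (Fintype.card V + 1) / 2} := by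
    have : Nonempty V := Fintype.card_pos_iff.1 (by omega)
    exact ⟨⟨{Classical.arbitrary V}, by simp, by rw [Finset.card_singleton]; omega⟩⟩
  unfold vertexExpansion
  obtain ⟨S, hS⟩ := exists_eq_ciInf_of_finite (f := fun S :
    {S : Finset V // 1 ≤ S.card ∧ S.card ≤ (Fintype.card V + 1) / 2} =>
    ((boundary G S.1).card : ℝ) / (S.1.card : ℝ))
  rw [← hS]
  obtain ⟨S, h1, h2⟩ := S
  obtain ⟨u, hu, v, hv, huv⟩ := exists_adj_notMem_of_connected hG
    (Finset.card_pos.1 h1) (by omega)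
  have : 0 < (boundary G S).card := Finset.card_pos.2 ⟨v, mem_boundary.2 ⟨hv, u, hu, huv⟩⟩
  have h1' : (0 : ℝ) < S.card := by exact_mod_cast h1
  have h2' : (0 : ℝ) < (boundary G S).card := by exact_mod_cast this
  exact div_pos h2' h1'

/-- `U` is a set of nodes outside `L` that `f` matches injectively to neighbors in `L`. -/
def IsCutMatching (G : SimpleGraph V) (L U : Finset V) (f : V → V) : Prop :=
  (∀ u ∈ U, u ∉ L ∧ f u ∈ L ∧ G.Adj u (f u)) ∧ Set.InjOn f U

/-- Every cut has a matching whose size is at least a third of the expansion times the size of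
its smaller side: the endpoints of a maximal matching separate the rest of either side from the
rest of the other, hence contain the boundary of that rest. -/
theorem exists_isCutMatching (hV : 1 ≤ Fintype.card V) (L : Finset V) :
    ∃ (U : Finset V) (f : V → V), IsCutMatching G L U f ∧
      vertexExpansion G * (min L.card (Fintype.card V - L.card) : ℕ) ≤ 3 * U.card := by
  classical
  obtain ⟨⟨U, f⟩, hmem, hmax⟩ := Finset.exists_max_image
    (Finset.univ.filter fun q : Finset V × (V → V) => IsCutMatching G L q.1 q.2)
    (fun q => q.1.card)
    ⟨(∅, id), Finset.mem_filter.2 ⟨Finset.mem_univ _, by simp, by simp⟩⟩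
  simp only [Finset.mem_filter, Finset.mem_univ, true_and, Prod.forall] at hmem hmax
  refine ⟨U, f, hmem, ?_⟩
  set A := U.image f with hA
  have hAcard : A.card = U.card := Finset.card_image_of_injOn hmem.2
  have hAL : A ⊆ L := by
    intro v hv
    obtain ⟨u, hu, rfl⟩ := Finset.mem_image.1 hv
    exact (hmem.1 u hu).2.1
  have hUL : U ⊆ Lᶜ := fun u hu => by simpa using (hmem.1 u hu).1
  have hsep : ∀ a ∈ L, a ∉ A → ∀ b ∉ L, b ∉ U → ¬ G.Adj a b := by
    intro a ha haA b hb hbU hab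
    have := hmax (insert b U) (Function.update f b a) ?_
    · rw [Finset.card_insert_of_notMem hbU] at this
      omega
    · have hf : ∀ u ∈ U, Function.update f b a u = f u := fun u hu =>
        Function.update_of_ne (by rintro rfl; exact hbU hu) _ _
      refine ⟨?_, ?_⟩
      · intro u hu
        rcases Finset.mem_insert.1 hu with rfl | hu
        · simpa using ⟨hb, ha, hab.symm⟩
        · rw [hf u hu]; exact hmem.1 u hu
      · rw [Finset.coe_insert, Set.injOn_insert (by exact_mod_cast hbU)]
        refine ⟨hmem.2.congr fun u hu => (hf u hu).symm, ?_⟩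
        rintro ⟨u, hu, hfu⟩
        rw [hf u hu, Function.update_self] at hfu
        exact haA (Finset.mem_image.2 ⟨u, hu, hfu⟩)
  have hα := vertexExpansion_le_one (G := G) hV
  have hUn : U.card + L.card ≤ Fintype.card V := by
    have := Finset.card_le_card hUL
    rw [Finset.card_compl] at this
    have := Finset.card_le_univ L
    omega
  -- the part of one side that the matching leaves uncovered has its boundary in the cover
  have main : ∀ S : Finset V, S.card ≤ (Fintype.card V + 1) / 2 → boundary G S ⊆ A ∪ U →
      ∀ x : ℕ, x ≤ S.card + U.card → vertexExpansion G * x ≤ 3 * U.card := by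
    intro S hS hb x hx
    have h1 := vertexExpansion_mul_card_le (G := G) hS
    have h2 : ((boundary G S).card : ℝ) ≤ 2 * U.card := by
      have := (Finset.card_le_card hb).trans (Finset.card_union_le A U)
      rw [hAcard] at this
      have h3 : (boundary G S).card ≤ 2 * U.card := by omega
      exact_mod_cast h3
    have hx' : (x : ℝ) ≤ S.card + U.card := by exact_mod_cast hx
    have h0 : 0 ≤ vertexExpansion G := Real.iInf_nonneg fun _ => by positivity
    have hU0 : (0 : ℝ) ≤ U.card := by positivity
    nlinarith
  have hALc := Finset.card_sdiff_add_card_eq_card hAL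
  have hULc := Finset.card_sdiff_add_card_eq_card hUL
  rw [Finset.card_compl] at hULc
  rcases le_total L.card (Fintype.card V - L.card) with hle | hle
  · rw [min_eq_left hle]
    refine main (L \ A) (by omega) ?_ _ (by omega)
    intro v hv
    obtain ⟨hv, u, hu, huv⟩ := mem_boundary.1 hv
    rw [Finset.mem_sdiff] at hu hv
    by_contra hvn
    rw [Finset.mem_union, not_or] at hvn
    exact hsep u hu.1 hu.2 v (fun h => hv ⟨h, hvn.1⟩) hvn.2 huv
  · rw [min_eq_right hle]
    refine main (Lᶜ \ U) (by omega) ?_ _ (by omega)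
    intro v hv
    obtain ⟨hv, u, hu, huv⟩ := mem_boundary.1 hv
    rw [Finset.mem_sdiff, Finset.mem_compl] at hu hv
    by_contra hvn
    rw [Finset.mem_union, not_or] at hvn
    exact hsep v (by by_contra h; exact hv ⟨h, hvn.2⟩) hvn.1 u hu.1 hu.2 huv.symm

end Cut

/-! ### A single round without hash collisions -/

section Round

variable {V τ : Type*}

theorem IsRoundOutcome.subset {S S' : TokenState V τ} {p : Proposals V}
    (h : IsRoundOutcome S p S') (w : V) : S w ⊆ S' w := by
  obtain ⟨_, _, _, _, _, h⟩ := h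
  exact fun x hx => (h w x).2 (Or.inl hx)

theorem mem_allTokens [Fintype V] {S : TokenState V τ} {x : τ} :
    x ∈ allTokens S ↔ ∃ v, x ∈ S v := by
  simp [allTokens]

theorem subset_allTokens [Fintype V] (S : TokenState V τ) (v : V) : S v ⊆ allTokens S :=
  fun _ hx => mem_allTokens.2 ⟨v, hx⟩

theorem IsRoundOutcome.allTokens_eq [Fintype V] {S S' : TokenState V τ} {p : Proposals V}
    (h : IsRoundOutcome S p S') : allTokens S' = allTokens S := by
  ext x
  rw [mem_allTokens, mem_allTokens]
  constructor
  · obtain ⟨acc, fwd, bwd, _, htr, h⟩ := h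
    rintro ⟨w, hx⟩
    rcases (h w x).1 hx with hx | ⟨u, hu, hx⟩ | ⟨v, hv, hx⟩
    · exact ⟨w, hx⟩
    · exact ⟨u, ((htr u w hu).1.1 x hx).1⟩
    · exact ⟨v, ((htr w v hv).2.1 x hx).1⟩
  · rintro ⟨w, hx⟩
    exact ⟨w, h.subset w hx⟩

theorem mem_candidates [Fintype V] {β : Type*} {G : SimpleGraph V} {H : Finset τ → β}
    {S : TokenState V τ} {u v : V} :
    v ∈ candidates G H S u ↔ (G.Adj u v ∧ H (S v) ≠ H (S u)) ∧
      ∀ w, G.Adj u w → H (S w) ≠ H (S u) → (S v).card ≤ (S w).card := by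
  classical
  rw [candidates, Finset.mem_filter]
  simp [advertisement]

theorem mem_candidates_id [Fintype V] {G : SimpleGraph V} {S : TokenState V τ} {u v : V} :
    v ∈ candidates G id S u ↔ (G.Adj u v ∧ S v ≠ S u) ∧
      ∀ w, G.Adj u w → S w ≠ S u → (S v).card ≤ (S w).card :=
  mem_candidates

theorem mem_jointChoices [Fintype V] {β : Type*} {G : SimpleGraph V} {H : Finset τ → β}
    {S : TokenState V τ} {p : Proposals V} :
    p ∈ jointChoices G H S ↔ ∀ u, p u ∈ choices G H S u := by
  classical
  simp only [jointChoices, Fintype.mem_piFinset]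

theorem mem_candidates_of_mem_jointChoices [Fintype V] {β : Type*} {G : SimpleGraph V}
    {H : Finset τ → β} {S : TokenState V τ} {p : Proposals V} (hp : p ∈ jointChoices G H S)
    {u v : V} (h : p u = some v) : v ∈ candidates G H S u := by
  have := mem_jointChoices.1 hp u
  rw [h, choices] at this
  split_ifs at this with hc
  · simp at this
  · simpa using this

/-- A node of minimal token count that receives a proposal learns a token: the proposer it
accepts has a different token set that is at least as large. -/
theorem IsRoundOutcome.card_lt [Fintype V] {G : SimpleGraph V} {S S' : TokenState V τ}
    {p : Proposals V} (hp : p ∈ jointChoices G id S) (h : IsRoundOutcome S p S') {u v : V}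
    (huv : p u = some v) (hmin : ∀ w, (S v).card ≤ (S w).card) :
    (S v).card < (S' v).card := by
  obtain ⟨acc, fwd, bwd, hacc, htr, hS'⟩ := h
  obtain ⟨w, hw⟩ := Option.ne_none_iff_exists'.1 (hacc.2 u v huv)
  have hne := (mem_candidates_id.1 (mem_candidates_of_mem_jointChoices hp (hacc.1 w v hw))).1.2
  have hns : ¬ S w ⊆ S v := fun hsub => hne (Finset.eq_of_subset_of_card_le hsub (hmin w)).symm
  obtain ⟨hX, -, hXne⟩ := (htr w v hw).1
  obtain ⟨x, hx⟩ := hXne hns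
  refine Finset.card_lt_card ⟨fun y hy => (hS' v y).2 (Or.inl hy), fun hsub => ?_⟩
  exact (hX x hx).2 (hsub ((hS' v x).2 (Or.inr (Or.inl ⟨w, hw, hx⟩))))

variable [Fintype V]

/-- The nodes with at most `i` tokens. -/
def atMost (S : TokenState V τ) (i : ℕ) : Finset V :=
  Finset.univ.filter fun v => (S v).card ≤ i

theorem mem_atMost {S : TokenState V τ} {i : ℕ} {v : V} :
    v ∈ atMost S i ↔ (S v).card ≤ i := by
  simp [atMost]

/-- The neighbors of `u` with at most `i` tokens. -/
noncomputable def poorNeighbors (G : SimpleGraph V) (S : TokenState V τ) (i : ℕ) (u : V) :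
    Finset V := by
  classical
  exact (atMost S i).filter fun v => G.Adj u v

theorem mem_poorNeighbors {G : SimpleGraph V} {S : TokenState V τ} {i : ℕ} {u v : V} :
    v ∈ poorNeighbors G S i u ↔ (S v).card ≤ i ∧ G.Adj u v := by
  simp [poorNeighbors, mem_atMost]

theorem atMost_subset {S S' : TokenState V τ} (h : ∀ v, S v ⊆ S' v) (i : ℕ) :
    atMost S' i ⊆ atMost S i := fun v hv =>
  mem_atMost.2 ((Finset.card_le_card (h v)).trans (mem_atMost.1 hv))

theorem poorNeighbors_subset {G : SimpleGraph V} {S S' : TokenState V τ} (h : ∀ v, S v ⊆ S' v)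
    (i : ℕ) (u : V) : poorNeighbors G S' i u ⊆ poorNeighbors G S i u := fun v hv => by
  rw [mem_poorNeighbors] at hv ⊢
  exact ⟨(Finset.card_le_card (h v)).trans hv.1, hv.2⟩

theorem candidates_eq_poorNeighbors {G : SimpleGraph V} {S : TokenState V τ} {i : ℕ} {u : V}
    (hmin : ∀ v, i ≤ (S v).card) (hu : i < (S u).card) (hne : (poorNeighbors G S i u).Nonempty) :
    candidates G id S u = poorNeighbors G S i u := by
  obtain ⟨w, hw⟩ := hne
  rw [mem_poorNeighbors] at hw
  have hdiff : ∀ v, (S v).card ≤ i → S v ≠ S u := fun v hv h => by rw [h] at hv; omega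
  ext v
  rw [mem_candidates_id, mem_poorNeighbors]
  constructor
  · rintro ⟨⟨huv, -⟩, h⟩
    exact ⟨(h w hw.2 (hdiff w hw.1)).trans hw.1, huv⟩
  · rintro ⟨hv, huv⟩
    exact ⟨⟨huv, hdiff v hv⟩, fun w _ _ => hv.trans (hmin w)⟩

theorem choices_eq_poorNeighbors {G : SimpleGraph V} {S : TokenState V τ} {i : ℕ} {u : V}
    (hmin : ∀ v, i ≤ (S v).card) (hu : i < (S u).card) (hne : (poorNeighbors G S i u).Nonempty) :
    choices G id S u = (poorNeighbors G S i u).map Function.Embedding.some := by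
  have h := candidates_eq_poorNeighbors hmin hu hne
  rw [choices, if_neg (by rw [h]; exact hne.ne_empty), h]

end Round

/-! ### Independent uniform choices -/

section Choices

variable {ι κ : Type*} [Fintype ι] [DecidableEq ι]

/-- Resampling one coordinate of a uniform element of a product preserves the distribution. -/
theorem sum_piFinset_update (t : ι → Finset κ) (u : ι) (F : (ι → κ) → ℝ) :
    ∑ p ∈ Fintype.piFinset t, ∑ c ∈ t u, F (Function.update p u c) =
      (t u).card * ∑ p ∈ Fintype.piFinset t, F p := by
  have h : ∀ q ∈ Fintype.piFinset t ×ˢ t u,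
      (Function.update q.1 u q.2, q.1 u) ∈ Fintype.piFinset t ×ˢ t u := by
    intro q hq
    rw [Finset.mem_product, Fintype.mem_piFinset] at hq ⊢
    refine ⟨fun w => ?_, hq.1 u⟩
    by_cases hw : w = u
    · subst hw; simpa using hq.2
    · simpa [Function.update_of_ne hw] using hq.1 w
  calc _ = ∑ q ∈ Fintype.piFinset t ×ˢ t u, F (Function.update q.1 u q.2) :=
        (Finset.sum_product' _ _ fun p c => F (Function.update p u c)).symm
    _ = ∑ q ∈ Fintype.piFinset t ×ˢ t u, F q.1 :=
        Finset.sum_nbij' (fun q => (Function.update q.1 u q.2, q.1 u))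
          (fun q => (Function.update q.1 u q.2, q.1 u)) h h (by simp) (by simp) (by simp)
    _ = _ := by
      rw [Finset.sum_product' _ _ fun p _ => F p]
      simp [Finset.mul_sum]

variable {V : Type*} [Fintype V]

open scoped Classical in
/-- The nodes of `W` that are hit by, that is, receive a proposal from a node other than `u`. -/
noncomputable def hitByOthers (p : Proposals V) (W : Finset V) (u : V) : Finset V :=
  W.filter fun v => ∃ w, w ≠ u ∧ p w = some v

open scoped Classical in
/-- The credit of `u` for the proposals `p`: one if the target of `u` is nobody else's target, and
one half if at least half of `W` is hit by other nodes. -/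
noncomputable def credit (p : Proposals V) (W : Finset V) (u : V) : ℝ :=
  (if ∀ w, w ≠ u → p w ≠ p u then 1 else 0) +
    (if W.card ≤ 2 * (hitByOthers p W u).card then 1 / 2 else 0)

open scoped Classical in
theorem hitByOthers_update (p : Proposals V) (W : Finset V) (u : V) (c : Option V) :
    hitByOthers (Function.update p u c) W u = hitByOthers p W u := by
  unfold hitByOthers
  refine Finset.filter_congr fun v _ => exists_congr fun w => and_congr_right fun hw => ?_
  rw [Function.update_of_ne hw]

open scoped Classical in
/-- A node that proposes uniformly to `W` earns credit at least one half on average: if the others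
hit less than half of `W`, the node picks a target of its own with probability at least `1 / 2`. -/
theorem half_le_sum_credit (t : V → Finset (Option V)) (u : V) {W : Finset V} (hW : W.Nonempty)
    (ht : t u = W.map Function.Embedding.some) :
    (1 / 2 : ℝ) * (Fintype.piFinset t).card ≤ ∑ p ∈ Fintype.piFinset t, credit p W u := by
  have hWpos : (0 : ℝ) < W.card := by exact_mod_cast hW.card_pos
  have hcard : (t u).card = W.card := by rw [ht, Finset.card_map]
  have key : ∀ p ∈ Fintype.piFinset t,
      (1 / 2 : ℝ) * W.card ≤ ∑ c ∈ t u, credit (Function.update p u c) W u := by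
    intro p _
    rw [ht, Finset.sum_map]
    by_cases hh : W.card ≤ 2 * (hitByOthers p W u).card
    · calc (1 / 2 : ℝ) * W.card = ∑ v ∈ W, (1 / 2 : ℝ) := by
            rw [Finset.sum_const, nsmul_eq_mul, mul_comm]
        _ ≤ _ := by
          refine Finset.sum_le_sum fun v _ => ?_
          unfold credit
          rw [hitByOthers_update, if_pos hh]
          split_ifs <;> norm_num
    · have hsub : W \ hitByOthers p W u ⊆ W := Finset.sdiff_subset
      have hle : (1 / 2 : ℝ) * W.card ≤ (W \ hitByOthers p W u).card := by
        have h1 := Finset.card_sdiff_add_card_eq_card (s := hitByOthers p W u) (t := W)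
          (Finset.filter_subset _ _)
        have h2 : W.card ≤ 2 * (W \ hitByOthers p W u).card := by omega
        have h3 : (W.card : ℝ) ≤ 2 * (W \ hitByOthers p W u).card := by exact_mod_cast h2
        linarith
      refine hle.trans ?_
      calc ((W \ hitByOthers p W u).card : ℝ)
          = ∑ v ∈ W \ hitByOthers p W u, (1 : ℝ) := by simp
        _ ≤ ∑ v ∈ W \ hitByOthers p W u,
              credit (Function.update p u (Function.Embedding.some v)) W u := by
            refine Finset.sum_le_sum fun v hv => ?_
            rw [Finset.mem_sdiff] at hv
            unfold credit
            rw [if_pos]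
            · split_ifs <;> norm_num
            · intro w hw hpw
              rw [Function.update_of_ne hw, Function.update_self] at hpw
              exact hv.2 (Finset.mem_filter.2 ⟨hv.1, w, hw, hpw⟩)
        _ ≤ _ := by
            refine Finset.sum_le_sum_of_subset_of_nonneg hsub fun v _ _ => ?_
            unfold credit
            split_ifs <;> norm_num
  have hsum := Finset.sum_le_sum key
  rw [sum_piFinset_update t u fun p => credit p W u, hcard, Finset.sum_const, nsmul_eq_mul] at hsum
  refine le_of_mul_le_mul_left ?_ hWpos
  linarith

end Choices

theorem size_add_one_le_size_of_two_mul_le {a b : ℕ} (hb : 1 ≤ b) (h : 2 * a ≤ b) :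
    Nat.size a + 1 ≤ Nat.size b := by
  rcases hs : Nat.size a with _ | s
  · exact Nat.lt_size.2 (by simpa using hb)
  · refine Nat.lt_size.2 ?_
    have := Nat.lt_size.1 (by omega : s < Nat.size a)
    rw [pow_succ]
    omega

/-! ### Spreading across a matching -/

section Phase

variable {V τ : Type*} [Fintype V] {G : SimpleGraph V}

theorem expect_gossipRound_le {β : Type*} {H : Finset τ → β} {R : Resolution V τ}
    {e : History V τ × TokenState V τ} {Ψ : TokenState V τ → ℝ≥0∞} {B : Proposals V → ℝ≥0∞}
    (h : ∀ p ∈ jointChoices G H e.2, ∀ S', IsRoundOutcome e.2 p S' → Ψ S' ≤ B p) :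
    expect (gossipRound G H R e) (fun e' => Ψ e'.2) ≤
      ((jointChoices G H e.2).card : ℝ≥0∞)⁻¹ * ∑ p ∈ jointChoices G H e.2, B p := by
  rw [gossipRound, expect_bind, proposalDist, expect_uniformOfFinset]
  gcongr with p hp
  rw [expect_map]
  exact expect_le_of_support fun S' hS' => h p hp S' (R.isRoundOutcome _ _ _ S' hS')

theorem gossipRound_support {β : Type*} {H : Finset τ → β} {R : Resolution V τ}
    {e e' : History V τ × TokenState V τ} (h : e' ∈ (gossipRound G H R e).support) :
    ∃ p ∈ jointChoices G H e.2, IsRoundOutcome e.2 p e'.2 := by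
  simp only [gossipRound, PMF.mem_support_bind_iff, PMF.mem_support_map_iff] at h
  obtain ⟨p, hp, S', hS', rfl⟩ := h
  exact ⟨p, (PMF.mem_support_uniformOfFinset_iff _ _).1 hp, R.isRoundOutcome _ _ _ S' hS'⟩

theorem gossipRound_support_subset {β : Type*} {H : Finset τ → β} {R : Resolution V τ}
    {e e' : History V τ × TokenState V τ} (h : e' ∈ (gossipRound G H R e).support) (v : V) :
    e.2 v ⊆ e'.2 v := by
  obtain ⟨p, -, h⟩ := gossipRound_support h
  exact h.subset v

open scoped Classical in
/-- Each node of `U` whose target in the minimal class is nobody else's target accounts for a node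
of its own that leaves the class. -/
theorem IsRoundOutcome.card_unique_add_card_atMost_le {S S' : TokenState V τ} {p : Proposals V}
    (hp : p ∈ jointChoices G id S) (h : IsRoundOutcome S p S') {i : ℕ}
    (hmin : ∀ v, i ≤ (S v).card) {U : Finset V}
    (hU : ∀ u ∈ U, i < (S u).card ∧ (poorNeighbors G S i u).Nonempty) :
    (U.filter fun u => ∀ w, w ≠ u → p w ≠ p u).card + (atMost S' i).card ≤
      (atMost S i).card := by
  have htarget : ∀ u ∈ U, ∃ v ∈ atMost S i, p u = some v := by
    intro u hu
    have := mem_jointChoices.1 hp u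
    rw [choices_eq_poorNeighbors hmin (hU u hu).1 (hU u hu).2, Finset.mem_map] at this
    obtain ⟨v, hv, hpv⟩ := this
    exact ⟨v, mem_atMost.2 (mem_poorNeighbors.1 hv).1, hpv.symm⟩
  have hsub := atMost_subset h.subset i
  rw [← Finset.card_sdiff_add_card_eq_card hsub]
  refine Nat.add_le_add_right ?_ _
  refine Finset.card_le_card_of_injOn (fun u => (p u).getD u) ?_ ?_
  · intro u hu
    obtain ⟨hu, -⟩ := Finset.mem_filter.1 (Finset.mem_coe.1 hu)
    obtain ⟨v, hv, hpv⟩ := htarget u hu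
    simp only [hpv, Option.getD_some, Finset.coe_sdiff, Set.mem_sdiff, Finset.mem_coe]
    refine ⟨hv, fun hv' => ?_⟩
    have h1 := mem_atMost.1 hv
    have h2 := h.card_lt hp hpv fun w => h1.trans (hmin w)
    have h3 := mem_atMost.1 hv'
    have := hmin v
    omega
  · intro u hu w hw huw
    obtain ⟨hu, huniq⟩ := Finset.mem_filter.1 (Finset.mem_coe.1 hu)
    obtain ⟨hw, -⟩ := Finset.mem_filter.1 (Finset.mem_coe.1 hw)
    obtain ⟨v, -, hpv⟩ := htarget u hu
    obtain ⟨v', -, hpv'⟩ := htarget w hw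
    simp only [hpv, hpv', Option.getD_some] at huw
    by_contra hne
    exact huniq w (Ne.symm hne) (by rw [hpv, hpv', huw])

/-- The minimal-class neighbors of `u` that are hit by other nodes leave the class; if these are at
least half of them, the binary length of their number drops. -/
theorem IsRoundOutcome.size_poorNeighbors_lt {S S' : TokenState V τ} {p : Proposals V}
    (hp : p ∈ jointChoices G id S) (h : IsRoundOutcome S p S') {i : ℕ}
    (hmin : ∀ v, i ≤ (S v).card) {u : V} (hne : (poorNeighbors G S i u).Nonempty)
    (hhalf : (poorNeighbors G S i u).card ≤
      2 * (hitByOthers p (poorNeighbors G S i u) u).card) :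
    Nat.size (poorNeighbors G S' i u).card + 1 ≤ Nat.size (poorNeighbors G S i u).card := by
  classical
  refine size_add_one_le_size_of_two_mul_le hne.card_pos ?_
  have hsub : poorNeighbors G S' i u ⊆
      poorNeighbors G S i u \ hitByOthers p (poorNeighbors G S i u) u := by
    intro v hv
    refine Finset.mem_sdiff.2 ⟨poorNeighbors_subset h.subset i u hv, fun hv' => ?_⟩
    obtain ⟨hvW, w, -, hpw⟩ := Finset.mem_filter.1 hv'
    have h1 := (mem_poorNeighbors.1 hvW).1
    have h2 := h.card_lt hp hpw fun w => h1.trans (hmin w)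
    have h3 := (mem_poorNeighbors.1 hv).1
    have := hmin v
    omega
  have h1 := Finset.card_le_card hsub
  have h2 := Finset.card_sdiff_add_card_eq_card
    (s := hitByOthers p (poorNeighbors G S i u) u) (t := poorNeighbors G S i u)
    (Finset.filter_subset _ _)
  omega

/-- The real-valued potential of a phase that starts with the minimal class `L` and a matching of
`U` into `L`: the number of nodes that have yet to leave `L`, up to a constant, plus half the total
binary length of the numbers of neighbors that the nodes of `U` still have in the class. The constant `5 / 4 * |U|`
keeps the value nonnegative: fewer than `|U| / 4` nodes have left before the last round of the phase,
and at most `|U|` leaving nodes are counted in that round. -/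
noncomputable def phaseValue (G : SimpleGraph V) (i : ℕ) (L U : Finset V)
    (S : TokenState V τ) : ℝ :=
  5 / 4 * U.card - (L.card - (atMost S i).card) +
    1 / 2 * ∑ u ∈ U, (Nat.size (poorNeighbors G S i u).card : ℝ)

/-- The states in which fewer than `|U| / 4` nodes have left `L` since the start of the phase. -/
def Unfinished (i : ℕ) (L U : Finset V) (S : TokenState V τ) : Prop :=
  4 * L.card < U.card + 4 * (atMost S i).card

open scoped Classical in
/-- The potential of a phase, which vanishes once a quarter of `|U|` nodes have left `L`. -/
noncomputable def phasePotential (G : SimpleGraph V) (i : ℕ) (L U : Finset V)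
    (S : TokenState V τ) : ℝ≥0∞ :=
  if Unfinished i L U S then ENNReal.ofReal (phaseValue G i L U S) else 0

open scoped Classical in
theorem IsRoundOutcome.phasePotential_le {S S' : TokenState V τ} {p : Proposals V}
    (hp : p ∈ jointChoices G id S) (h : IsRoundOutcome S p S') {i : ℕ} {L U : Finset V}
    (hmin : ∀ v, i ≤ (S v).card) (hU : ∀ u ∈ U, i < (S u).card) (hS : Unfinished i L U S) :
    0 ≤ phaseValue G i L U S - (∑ u ∈ U.filter fun u => (poorNeighbors G S i u).Nonempty,
        credit p (poorNeighbors G S i u) u) ∧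
      phasePotential G i L U S' ≤ ENNReal.ofReal (phaseValue G i L U S -
        ∑ u ∈ U.filter fun u => (poorNeighbors G S i u).Nonempty,
          credit p (poorNeighbors G S i u) u) := by
  set U' := U.filter fun u => (poorNeighbors G S i u).Nonempty with hU'
  set Q := U'.filter fun u => ∀ w, w ≠ u → p w ≠ p u with hQ
  set A := U'.filter fun u => (poorNeighbors G S i u).card ≤
    2 * (hitByOthers p (poorNeighbors G S i u) u).card with hA
  have hcredit : ∑ u ∈ U', credit p (poorNeighbors G S i u) u = Q.card + 1 / 2 * A.card := by
    unfold credit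
    rw [Finset.sum_add_distrib, Finset.sum_ite, Finset.sum_ite]
    simp only [Finset.sum_const_zero, add_zero, Finset.sum_const, nsmul_eq_mul, mul_one]
    rw [mul_comm (1 / 2 : ℝ)]
  have hQle : Q.card + (atMost S' i).card ≤ (atMost S i).card :=
    h.card_unique_add_card_atMost_le hp hmin fun u hu =>
      ⟨hU u (Finset.mem_filter.1 hu).1, (Finset.mem_filter.1 hu).2⟩
  have hQU : Q.card ≤ U.card :=
    Finset.card_le_card ((Finset.filter_subset _ _).trans (Finset.filter_subset _ _))
  have hsize : A.card + ∑ u ∈ U, Nat.size (poorNeighbors G S' i u).card ≤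
      ∑ u ∈ U, Nat.size (poorNeighbors G S i u).card := by
    have hAU : A ⊆ U := (Finset.filter_subset _ _).trans (Finset.filter_subset _ _)
    have : A.card = ∑ u ∈ U, if u ∈ A then 1 else 0 := by
      rw [Finset.sum_ite_mem, Finset.inter_eq_right.2 hAU]; simp
    rw [this, ← Finset.sum_add_distrib]
    refine Finset.sum_le_sum fun u _ => ?_
    split_ifs with huA
    · obtain ⟨huU', hhalf⟩ := Finset.mem_filter.1 huA
      rw [add_comm]
      exact h.size_poorNeighbors_lt hp hmin (Finset.mem_filter.1 huU').2 hhalf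
    · rw [zero_add]
      exact Nat.size_le_size (Finset.card_le_card (poorNeighbors_subset h.subset i u))
  have hsizeR : (A.card : ℝ) + ∑ u ∈ U, (Nat.size (poorNeighbors G S' i u).card : ℝ) ≤
      ∑ u ∈ U, (Nat.size (poorNeighbors G S i u).card : ℝ) := by exact_mod_cast hsize
  have hnonneg : (0 : ℝ) ≤ ∑ u ∈ U, (Nat.size (poorNeighbors G S' i u).card : ℝ) := by positivity
  have hQleR : (Q.card : ℝ) + (atMost S' i).card ≤ (atMost S i).card := by exact_mod_cast hQle
  have hQUR : (Q.card : ℝ) ≤ U.card := by exact_mod_cast hQU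
  have hSR : (4 : ℝ) * L.card < U.card + 4 * (atMost S i).card := by exact_mod_cast hS
  rw [hcredit]
  refine ⟨by unfold phaseValue; linarith, ?_⟩
  unfold phasePotential
  split_ifs
  · refine ENNReal.ofReal_le_ofReal ?_
    unfold phaseValue
    linarith
  · exact zero_le

/-- During a phase the potential drops by `3 / 8 * |U|` per round in expectation: at least
`3 / 4 * |U|` nodes of `U` still have a neighbor in the minimal class, and each of them earns
credit at least one half. -/
theorem phasePotential_drift {R : Resolution V τ} {i : ℕ} {L U : Finset V} {f : V → V}
    (hM : IsCutMatching G L U f) {e : History V τ × TokenState V τ}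
    (hmin : ∀ v, i ≤ (e.2 v).card) (hL : atMost e.2 i ⊆ L) (hS : Unfinished i L U e.2) :
    expect (gossipRound G id R e) (fun e' => phasePotential G i L U e'.2) +
      ENNReal.ofReal (3 / 8 * U.card) ≤ phasePotential G i L U e.2 := by
  classical
  obtain ⟨h, S⟩ := e
  simp only at hmin hL hS ⊢
  have hU : ∀ u ∈ U, i < (S u).card := by
    intro u hu
    by_contra hlt
    exact (hM.1 u hu).1 (hL (mem_atMost.2 (not_lt.1 hlt)))
  set J := jointChoices G id S with hJ
  have hJne : J.Nonempty := jointChoices_nonempty G id S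
  have hJpos : (0 : ℝ) < J.card := by exact_mod_cast hJne.card_pos
  set U' := U.filter fun u => (poorNeighbors G S i u).Nonempty with hU'
  set B : Proposals V → ℝ := fun p => phaseValue G i L U S -
    ∑ u ∈ U', credit p (poorNeighbors G S i u) u with hB
  have hbound : expect (gossipRound G id R (h, S)) (fun e' => phasePotential G i L U e'.2) ≤
      (J.card : ℝ≥0∞)⁻¹ * ∑ p ∈ J, ENNReal.ofReal (B p) :=
    expect_gossipRound_le fun p hp S' hS' => (hS'.phasePotential_le hp hmin hU hS).2
  have hBnonneg : ∀ p ∈ J, 0 ≤ B p := by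
    intro p hp
    obtain ⟨S', hS'⟩ := (R.next h S p).support_nonempty
    exact ((R.isRoundOutcome h S p S' hS').phasePotential_le hp hmin hU hS).1
  have hcredit : ∀ u ∈ U', (1 / 2 : ℝ) * J.card ≤
      ∑ p ∈ J, credit p (poorNeighbors G S i u) u := by
    intro u hu
    obtain ⟨hu, hne⟩ := Finset.mem_filter.1 hu
    exact half_le_sum_credit (fun u => choices G id S u) u hne
      (choices_eq_poorNeighbors hmin (hU u hu) hne)
  have halive : (U.card : ℝ) - (L.card - (atMost S i).card) ≤ U'.card := by
    have h1 : (U.filter fun u => ¬ (poorNeighbors G S i u).Nonempty).card ≤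
        (L \ atMost S i).card := by
      refine Finset.card_le_card_of_injOn f ?_ ?_
      · intro u hu
        obtain ⟨hu, hne⟩ := Finset.mem_filter.1 (Finset.mem_coe.1 hu)
        refine Finset.mem_coe.2 (Finset.mem_sdiff.2 ⟨(hM.1 u hu).2.1, fun hf => hne ?_⟩)
        exact ⟨f u, mem_poorNeighbors.2 ⟨mem_atMost.1 hf, (hM.1 u hu).2.2⟩⟩
      · exact hM.2.mono fun u hu => (Finset.mem_filter.1 (Finset.mem_coe.1 hu)).1
    have h2 := Finset.card_sdiff_add_card_eq_card hL
    have h3 := Finset.card_filter_add_card_filter_not (s := U)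
      (fun u => (poorNeighbors G S i u).Nonempty)
    have h4 : U.card + (atMost S i).card ≤ U'.card + L.card := by
      rw [hU']; omega
    have h5 : (U.card : ℝ) + (atMost S i).card ≤ U'.card + L.card := by exact_mod_cast h4
    linarith
  have hSR : (4 : ℝ) * L.card < U.card + 4 * (atMost S i).card := by exact_mod_cast hS
  have hsum : ∑ p ∈ J, B p ≤ J.card * (phaseValue G i L U S - 3 / 8 * U.card) := by
    have h1 := Finset.sum_le_sum hcredit
    rw [Finset.sum_comm, Finset.sum_const, nsmul_eq_mul] at h1
    rw [hB, Finset.sum_sub_distrib, Finset.sum_const, nsmul_eq_mul]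
    nlinarith
  have hval : 0 ≤ phaseValue G i L U S - 3 / 8 * U.card := by
    have := (Finset.sum_nonneg hBnonneg).trans hsum
    exact nonneg_of_mul_nonneg_right this hJpos
  have hmean : (J.card : ℝ≥0∞)⁻¹ * ∑ p ∈ J, ENNReal.ofReal (B p) ≤
      ENNReal.ofReal (phaseValue G i L U S - 3 / 8 * U.card) := by
    rw [← ENNReal.ofReal_sum_of_nonneg hBnonneg, ← ENNReal.div_eq_inv_mul]
    refine ENNReal.div_le_of_le_mul ?_
    rw [← ENNReal.ofReal_natCast, ← ENNReal.ofReal_mul hval]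
    exact ENNReal.ofReal_le_ofReal (hsum.trans_eq (mul_comm _ _))
  calc _ ≤ ENNReal.ofReal (phaseValue G i L U S - 3 / 8 * U.card) +
        ENNReal.ofReal (3 / 8 * U.card) := by gcongr; exact hbound.trans hmean
    _ = ENNReal.ofReal (phaseValue G i L U S) := by
        rw [← ENNReal.ofReal_add hval (by positivity)]; congr 1; ring
    _ = phasePotential G i L U S := by rw [phasePotential, if_pos hS]

/-- Within a number of rounds proportional to the binary length of the maximum degree, a quarter
of the matched nodes leave the minimal class with probability at least one half. -/
theorem expect_unfinished_le [DecidableRel G.Adj] {R : Resolution V τ} {i : ℕ} {U : Finset V}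
    {f : V → V} {e : History V τ × TokenState V τ} (hM : IsCutMatching G (atMost e.2 i) U f)
    (hmin : ∀ v, i ≤ (e.2 v).card) (hU : U.Nonempty) :
    expect (iterKernel (gossipRound G id R) (10 * Nat.size G.maxDegree) e)
      (Set.indicator {e' | Unfinished i (atMost e.2 i) U e'.2} 1) ≤ 1 / 2 := by
  classical
  set L := atMost e.2 i with hLdef
  set t := 10 * Nat.size G.maxDegree with ht
  have hUpos : (0 : ℝ) < U.card := by exact_mod_cast hU.card_pos
  have hbound := iterKernel_drift (K := gossipRound G id R)
    (I := fun e' => (∀ v, i ≤ (e'.2 v).card) ∧ atMost e'.2 i ⊆ L)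
    (N := {e' | Unfinished i L U e'.2}) (Ψ := fun e' => phasePotential G i L U e'.2)
    (ε := ENNReal.ofReal (3 / 8 * U.card))
    (fun x hx y hy => ⟨fun v => (hx.1 v).trans
      (Finset.card_le_card (gossipRound_support_subset hy v)),
      (atMost_subset (gossipRound_support_subset hy) i).trans hx.2⟩)
    (fun x _ y hy hyN => by
      have := Finset.card_le_card (atMost_subset (gossipRound_support_subset hy) i)
      simp only [Set.mem_ofPred_eq, Unfinished] at hyN ⊢
      omega)
    (fun x hx hxN => phasePotential_drift hM hx.1 hx.2 hxN)
    (fun x _ hxN => if_neg hxN) e ⟨hmin, subset_rfl⟩ t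
  have hdeg : ∀ u ∈ U, (poorNeighbors G e.2 i u).card ≤ G.maxDegree := by
    intro u _
    refine le_trans (Finset.card_le_card ?_) (G.degree_le_maxDegree u)
    intro v hv
    exact (G.mem_neighborFinset u v).2 (mem_poorNeighbors.1 hv).2
  have hsize1 : 1 ≤ Nat.size G.maxDegree := by
    obtain ⟨u, hu⟩ := hU
    refine Nat.lt_size.2 ?_
    refine le_trans ?_ (hdeg u hu)
    exact Finset.card_pos.2 ⟨f u, mem_poorNeighbors.2
      ⟨mem_atMost.1 (hM.1 u hu).2.1, (hM.1 u hu).2.2⟩⟩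
  have hsize1R : (1 : ℝ) ≤ Nat.size G.maxDegree := by exact_mod_cast hsize1
  have hval : phaseValue G i L U e.2 ≤ t * (3 / 8 * U.card) * (1 / 2) := by
    have h1 : ∑ u ∈ U, (Nat.size (poorNeighbors G e.2 i u).card : ℝ) ≤
        U.card * Nat.size G.maxDegree := by
      rw [← nsmul_eq_mul]
      exact Finset.sum_le_card_nsmul _ _ _ fun u hu => by
        exact_mod_cast Nat.size_le_size (hdeg u hu)
    rw [ht]
    unfold phaseValue
    rw [← hLdef]
    push_cast
    nlinarith
  have hpot : phasePotential G i L U e.2 ≤ t * ENNReal.ofReal (3 / 8 * U.card) * (1 / 2) := by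
    unfold phasePotential
    split_ifs
    · refine (ENNReal.ofReal_le_ofReal hval).trans_eq ?_
      rw [ENNReal.ofReal_mul (by positivity), ENNReal.ofReal_mul (by positivity),
        ENNReal.ofReal_natCast, ENNReal.ofReal_div_of_pos (by norm_num)]
      simp
    · exact zero_le
  have hmul := hbound.trans hpot
  rwa [ENNReal.mul_le_mul_iff_right] at hmul
  · refine mul_ne_zero ?_ ?_
    · rw [Nat.cast_ne_zero]; omega
    · rw [Ne, ENNReal.ofReal_eq_zero, not_le]; positivity
  · exact ENNReal.mul_ne_top (ENNReal.natCast_ne_top _) ENNReal.ofReal_ne_top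

end Phase

/-! ### Progress in one phase -/

section Progress

variable {V τ : Type*} [Fintype V] {G : SimpleGraph V}

theorem GossipSolved.mono {T S S' : TokenState V τ} (h : GossipSolved T S)
    (hsub : ∀ v, S v ⊆ S' v) : GossipSolved T S' := fun v => (h v).trans (hsub v)

theorem iterKernel_gossipRound_support {β : Type*} {H : Finset τ → β} {R : Resolution V τ}
    {t : ℕ} {e e' : History V τ × TokenState V τ}
    (h : e' ∈ (iterKernel (gossipRound G H R) t e).support) :
    (∀ v, e.2 v ⊆ e'.2 v) ∧ allTokens e'.2 = allTokens e.2 := by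
  refine iterKernel_support_rel
    (Q := fun e e' => (∀ v, e.2 v ⊆ e'.2 v) ∧ allTokens e'.2 = allTokens e.2)
    (fun x => ⟨fun _ => subset_rfl, rfl⟩)
    (fun x y z => ?_) (fun x y hy => ?_) t e e' h
  · exact fun h1 h2 => ⟨fun v => (h1.1 v).trans (h2.1 v), h2.2.trans h1.2⟩
  obtain ⟨p, -, hp⟩ := gossipRound_support hy
  exact ⟨hp.subset, hp.allTokens_eq⟩

/-- If gossip is not solved then two adjacent nodes have different token sets. -/
theorem exists_adj_ne (hG : G.Connected) {S : TokenState V τ} (hS : ¬ GossipSolved S S) :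
    ∃ u v, G.Adj u v ∧ S u ≠ S v := by
  classical
  simp only [GossipSolved, not_forall, Finset.not_subset] at hS
  obtain ⟨a, x, hx, hxa⟩ := hS
  obtain ⟨b, hb⟩ := mem_allTokens.1 hx
  obtain ⟨u, hu, v, hv, huv⟩ := exists_adj_notMem_of_connected hG
    (S := Finset.univ.filter fun v => x ∈ S v) ⟨b, by simpa using hb⟩
    (by
      rw [← Finset.card_univ]
      refine Finset.card_lt_card (Finset.ssubset_univ_iff.2 fun h => hxa ?_)
      have ha := Finset.mem_univ a
      rw [← h] at ha
      simpa using ha)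
  exact ⟨u, v, huv, fun h => by simp_all⟩

/-- When all nodes are in the minimal class, some node leaves it in the very next round. -/
theorem card_atMost_lt_of_gossipRound {R : Resolution V τ} (hG : G.Connected)
    {e e' : History V τ × TokenState V τ} (hS : ¬ GossipSolved e.2 e.2) {i : ℕ}
    (hi : ∀ v, (e.2 v).card = i) (he : e' ∈ (gossipRound G id R e).support) :
    (atMost e'.2 i).card < Fintype.card V := by
  obtain ⟨p, hp, hout⟩ := gossipRound_support he
  obtain ⟨u, v, huv, hne⟩ := exists_adj_ne hG hS
  obtain ⟨w, hw⟩ : ∃ w, p u = some w := by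
    have h1 := mem_jointChoices.1 hp u
    have hv : v ∈ candidates G id e.2 u :=
      mem_candidates_id.2 ⟨⟨huv, hne.symm⟩, fun w _ _ => by rw [hi, hi]⟩
    rw [choices, if_neg (Finset.ne_empty_of_mem hv), Finset.mem_map] at h1
    obtain ⟨w, -, hw⟩ := h1
    exact ⟨w, hw.symm⟩
  have hlt := hout.card_lt hp hw fun x => by rw [hi, hi]
  rw [← Finset.card_univ]
  refine Finset.card_lt_card (Finset.ssubset_univ_iff.2 fun h => ?_)
  have := mem_atMost.1 (h.symm ▸ Finset.mem_univ w)
  rw [hi] at hlt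
  omega

/-- The number of nodes that left a class of `x` nodes, of which `x'` remain, is too small
compared to the smaller side of the cut. The summand `1` makes the removal of one node sufficient
when all nodes are in the class, so that the smaller side is empty. -/
def SmallProgress (n : ℕ) (α : ℝ) (x x' : ℕ) : Prop :=
  24 * ((x : ℝ) - x') < α * ((min x (n - x) : ℕ) + 1)

/-- In every phase some class of poor nodes shrinks substantially with probability one half. -/
theorem exists_expect_smallProgress_le [DecidableRel G.Adj] {R : Resolution V τ}
    (hG : G.Connected) (hV : 2 ≤ Fintype.card V) {e : History V τ × TokenState V τ}
    (hS : ¬ GossipSolved e.2 e.2) :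
    ∃ i < (allTokens e.2).card,
      expect (iterKernel (gossipRound G id R) (10 * Nat.size G.maxDegree) e)
        (Set.indicator {e' | SmallProgress (Fintype.card V) (vertexExpansion G)
          (atMost e.2 i).card (atMost e'.2 i).card} 1) ≤ 1 / 2 := by
  classical
  have hα0 := vertexExpansion_pos hG hV
  have hα1 := vertexExpansion_le_one (G := G) (by omega)
  have hneV : (Finset.univ : Finset V).Nonempty :=
    Finset.card_pos.1 (by rw [Finset.card_univ]; omega)
  obtain ⟨v₀, -, hv₀⟩ := Finset.exists_min_image Finset.univ (fun v => (e.2 v).card) hneV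
  have hmin : ∀ v, (e.2 v₀).card ≤ (e.2 v).card := fun v => hv₀ v (Finset.mem_univ v)
  set i := (e.2 v₀).card with hi
  refine ⟨i, ?_, ?_⟩
  · simp only [GossipSolved, not_forall] at hS
    obtain ⟨v, hv⟩ := hS
    exact (hmin v).trans_lt (Finset.card_lt_card ⟨subset_allTokens _ _, hv⟩)
  set n := Fintype.card V with hn
  set x := (atMost e.2 i).card with hx
  have hxn : x ≤ n := Finset.card_le_univ _
  have hxpos : 1 ≤ x := Finset.card_pos.2 ⟨v₀, mem_atMost.2 hi.ge⟩
  rcases hxn.lt_or_eq with hlt | heq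
  · obtain ⟨U, f, hM, hU⟩ := exists_isCutMatching (G := G) (by omega) (atMost e.2 i)
    rw [← hx, ← hn] at hU
    have hminpos : 1 ≤ min x (n - x) := by rw [le_min_iff]; omega
    have hminR : (1 : ℝ) ≤ (min x (n - x) : ℕ) := by exact_mod_cast hminpos
    have hUne : U.Nonempty := by
      rw [← Finset.card_pos]
      have : (0 : ℝ) < 3 * U.card := lt_of_lt_of_le (by positivity) hU
      have h' : (0 : ℝ) < U.card := by linarith
      exact_mod_cast h'
    refine le_trans (expect_mono fun e' _ => ?_) (expect_unfinished_le (R := R) hM hmin hUne)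
    refine Set.indicator_le_indicator_apply_of_subset ?_ zero_le
    intro y hy
    simp only [Set.mem_ofPred_eq, SmallProgress, Unfinished] at hy ⊢
    have : (4 : ℝ) * x < U.card + 4 * (atMost y.2 i).card := by nlinarith
    rw [hx] at this
    exact_mod_cast this
  · refine le_trans (expect_le_of_support (a := 0) fun e' he' => ?_) zero_le
    have hall : ∀ v, (e.2 v).card = i := by
      intro v
      refine le_antisymm (mem_atMost.1 ?_) (hmin v)
      rw [Finset.card_eq_iff_eq_univ _ |>.1 heq]
      exact Finset.mem_univ v
    obtain ⟨t, ht⟩ : ∃ t, 10 * Nat.size G.maxDegree = 1 + t := by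
      obtain ⟨u, v, huv, -⟩ := exists_adj_ne hG hS
      have h1 : 0 < G.degree u := (G.degree_pos_iff_exists_adj u).2 ⟨v, huv⟩
      have h2 : 0 < Nat.size G.maxDegree :=
        Nat.lt_size.2 (h1.trans_le (G.degree_le_maxDegree u))
      exact ⟨10 * Nat.size G.maxDegree - 1, by omega⟩
    rw [ht, iterKernel_add, PMF.mem_support_bind_iff] at he'
    obtain ⟨z, hz, he'⟩ := he'
    have hz1 : z ∈ (gossipRound G id R e).support := by
      simpa [iterKernel, PMF.pure_bind] using hz
    have h1 := card_atMost_lt_of_gossipRound hG hS hall hz1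
    have h2 := Finset.card_le_card (atMost_subset (iterKernel_gossipRound_support he').1 i)
    rw [Set.indicator_of_notMem]
    simp only [Set.mem_ofPred_eq, SmallProgress, not_lt]
    have h3 : (atMost e'.2 i).card + 1 ≤ x := by omega
    have h4 : ((atMost e'.2 i).card : ℝ) + 1 ≤ x := by exact_mod_cast h3
    have h5 : min x (n - x) = 0 := by omega
    rw [h5]
    push_cast
    linarith

/-! ### The global potential -/

/-- How far the removal of nodes from a class of `x` out of `n` nodes has advanced: it increases
from `-log (n + 1)` to `log (n + 1)` as `x` decreases from `n` to zero, and it increases by a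
constant when the smaller side of the cut changes by a constant factor. -/
noncomputable def advance (n x : ℕ) : ℝ :=
  Real.log ((n : ℝ) - x + 1) - Real.log ((x : ℝ) + 1)

theorem advance_le_advance {n x x' : ℕ} (hxn : x ≤ n) (h : x' ≤ x) :
    advance n x ≤ advance n x' := by
  have h1 : (x : ℝ) ≤ n := by exact_mod_cast hxn
  have h2 : (x' : ℝ) ≤ x := by exact_mod_cast h
  unfold advance
  refine sub_le_sub (Real.log_le_log (by linarith) (by linarith))
    (Real.log_le_log (by positivity) (by linarith))

theorem advance_le_log {n x : ℕ} (hxn : x ≤ n) : advance n x ≤ Real.log ((n : ℝ) + 1) := by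
  simpa [advance] using advance_le_advance hxn (Nat.zero_le x)

theorem neg_log_le_advance {n x : ℕ} (hxn : x ≤ n) :
    -Real.log ((n : ℝ) + 1) ≤ advance n x := by
  simpa [advance] using advance_le_advance le_rfl hxn

theorem advance_add_le {n x x' : ℕ} {α : ℝ} (hα0 : 0 < α) (hα1 : α ≤ 1) (hxn : x ≤ n)
    (hx' : x' ≤ x) (h : ¬ SmallProgress n α x x') : advance n x + α / 48 ≤ advance n x' := by
  rw [SmallProgress, not_lt] at h
  have h1 : (x : ℝ) ≤ n := by exact_mod_cast hxn
  have h2 : (x' : ℝ) ≤ x := by exact_mod_cast hx'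
  have h3 : (0 : ℝ) ≤ x' := by positivity
  unfold advance
  rcases le_total x (n - x) with hle | hle
  · rw [min_eq_left hle] at h
    have hlog : Real.log ((n : ℝ) - x + 1) ≤ Real.log ((n : ℝ) - x' + 1) :=
      Real.log_le_log (by linarith) (by linarith)
    have hratio := Real.one_sub_inv_le_log_of_pos
      (x := ((x : ℝ) + 1) / (x' + 1)) (by positivity)
    rw [Real.log_div (by positivity) (by positivity), inv_div] at hratio
    have : ((x' : ℝ) + 1) / (x + 1) ≤ 1 - α / 24 := by
      rw [div_le_iff₀ (by positivity)]
      linarith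
    linarith
  · rw [min_eq_right hle, Nat.cast_sub hxn] at h
    have hlog : Real.log ((x' : ℝ) + 1) ≤ Real.log ((x : ℝ) + 1) :=
      Real.log_le_log (by linarith) (by linarith)
    have hpos : (0 : ℝ) < (n : ℝ) - x + 1 := by linarith
    have hgrow : Real.log (((n : ℝ) - x + 1) * (1 + α / 24)) ≤ Real.log ((n : ℝ) - x' + 1) :=
      Real.log_le_log (by positivity) (by nlinarith)
    rw [Real.log_mul hpos.ne' (by positivity)] at hgrow
    have hratio := Real.one_sub_inv_le_log_of_pos (x := 1 + α / 24) (by positivity)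
    have : (1 + α / 24)⁻¹ ≤ 1 - α / 48 := by
      rw [inv_le_iff_one_le_mul₀ (by positivity)]
      nlinarith
    linarith

/-- The total progress of a state: the sum, over all numbers `i` smaller than the number `k` of
tokens, of the progress made in raising nodes above `i` tokens. -/
noncomputable def totalAdvance (k : ℕ) (S : TokenState V τ) : ℝ :=
  ∑ i ∈ Finset.range k, advance (Fintype.card V) (atMost S i).card

theorem totalAdvance_le (k : ℕ) (S : TokenState V τ) :
    totalAdvance k S ≤ k * Real.log ((Fintype.card V : ℝ) + 1) := by
  calc _ ≤ ∑ i ∈ Finset.range k, Real.log ((Fintype.card V : ℝ) + 1) :=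
        Finset.sum_le_sum fun i _ => advance_le_log (Finset.card_le_univ _)
    _ = _ := by simp

theorem neg_le_totalAdvance (k : ℕ) (S : TokenState V τ) :
    -(k * Real.log ((Fintype.card V : ℝ) + 1)) ≤ totalAdvance k S := by
  calc _ = ∑ i ∈ Finset.range k, -Real.log ((Fintype.card V : ℝ) + 1) := by simp
    _ ≤ _ := Finset.sum_le_sum fun i _ => neg_log_le_advance (Finset.card_le_univ _)

theorem totalAdvance_mono (k : ℕ) {S S' : TokenState V τ} (h : ∀ v, S v ⊆ S' v) :
    totalAdvance k S ≤ totalAdvance k S' :=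
  Finset.sum_le_sum fun i _ =>
    advance_le_advance (Finset.card_le_univ _) (Finset.card_le_card (atMost_subset h i))

theorem totalAdvance_add_le {α : ℝ} (hα0 : 0 < α) (hα1 : α ≤ 1) {k i : ℕ} (hi : i < k)
    {S S' : TokenState V τ} (h : ∀ v, S v ⊆ S' v)
    (hp : ¬ SmallProgress (Fintype.card V) α (atMost S i).card (atMost S' i).card) :
    totalAdvance k S + α / 48 ≤ totalAdvance k S' := by
  have h1 : ∀ S : TokenState V τ, totalAdvance k S =
      advance (Fintype.card V) (atMost S i).card +
        ∑ j ∈ (Finset.range k).erase i, advance (Fintype.card V) (atMost S j).card := fun S =>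
    (Finset.add_sum_erase _ _ (Finset.mem_range.2 hi)).symm
  have h2 := advance_add_le hα0 hα1 (Finset.card_le_univ _)
    (Finset.card_le_card (atMost_subset h i)) hp
  have h3 : ∑ j ∈ (Finset.range k).erase i, advance (Fintype.card V) (atMost S j).card ≤
      ∑ j ∈ (Finset.range k).erase i, advance (Fintype.card V) (atMost S' j).card :=
    Finset.sum_le_sum fun j _ =>
      advance_le_advance (Finset.card_le_univ _) (Finset.card_le_card (atMost_subset h j))
  rw [h1 S, h1 S']
  linarith

open scoped Classical in
/-- The exponential of the progress that is still missing, in units of the progress made in a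
successful phase; zero once gossip is solved. -/
noncomputable def globalPotential (α : ℝ) (S : TokenState V τ) : ℝ≥0∞ :=
  if GossipSolved S S then 0
  else ENNReal.ofReal (Real.exp (((allTokens S).card * Real.log ((Fintype.card V : ℝ) + 1) -
    totalAdvance (allTokens S).card S) / (α / 48)))

theorem one_le_globalPotential {α : ℝ} (hα : 0 < α) {S : TokenState V τ}
    (hS : ¬ GossipSolved S S) : 1 ≤ globalPotential α S := by
  rw [globalPotential, if_neg hS, ENNReal.one_le_ofReal, Real.one_le_exp_iff]
  have := totalAdvance_le (allTokens S).card S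
  exact div_nonneg (by linarith) (by positivity)

theorem globalPotential_le {α : ℝ} (hα : 0 < α) (S : TokenState V τ) :
    globalPotential α S ≤ ENNReal.ofReal (Real.exp
      (96 * ((allTokens S).card / α) * Real.log ((Fintype.card V : ℝ) + 1))) := by
  rw [globalPotential]
  split_ifs
  · exact zero_le
  · refine ENNReal.ofReal_le_ofReal (Real.exp_le_exp.2 ?_)
    have := neg_le_totalAdvance (allTokens S).card S
    rw [div_le_iff₀ (by positivity)]
    field_simp
    linarith

/-- In a phase the global potential shrinks by a constant factor in expectation: it never
increases, and it is at least halved with probability one half. -/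
theorem expect_globalPotential_le [DecidableRel G.Adj] {R : Resolution V τ}
    (hG : G.Connected) (hV : 2 ≤ Fintype.card V) (e : History V τ × TokenState V τ) :
    expect (iterKernel (gossipRound G id R) (10 * Nat.size G.maxDegree) e)
      (fun e' => globalPotential (vertexExpansion G) e'.2) ≤
      ENNReal.ofReal (3 / 4) * globalPotential (vertexExpansion G) e.2 := by
  classical
  have hα0 := vertexExpansion_pos hG hV
  have hα1 := vertexExpansion_le_one (G := G) (by omega)
  set α := vertexExpansion G with hα
  by_cases hS : GossipSolved e.2 e.2
  · refine (expect_le_of_support (a := 0) fun e' he' => ?_).trans zero_le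
    obtain ⟨hsub, htok⟩ := iterKernel_gossipRound_support he'
    rw [globalPotential, if_pos]
    have := hS.mono hsub
    rwa [GossipSolved, ← htok] at this
  obtain ⟨i, hi, hprob⟩ := exists_expect_smallProgress_le (R := R) hG hV hS
  set B : Set (History V τ × TokenState V τ) := {e' | SmallProgress (Fintype.card V) α
    (atMost e.2 i).card (atMost e'.2 i).card} with hB
  set μ := iterKernel (gossipRound G id R) (10 * Nat.size G.maxDegree) e with hμ
  have hpt : ∀ e' ∈ μ.support, globalPotential α e'.2 ≤
      globalPotential α e.2 * (1 / 2) + globalPotential α e.2 * (1 / 2) * B.indicator 1 e' := by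
    intro e' he'
    obtain ⟨hsub, htok⟩ := iterKernel_gossipRound_support he'
    by_cases hbad : e' ∈ B
    · rw [Set.indicator_of_mem hbad, Pi.one_apply, mul_one, ← mul_add, one_div,
        ENNReal.inv_two_add_inv_two, mul_one]
      rw [globalPotential, globalPotential, if_neg hS, htok]
      split_ifs
      · exact zero_le
      · refine ENNReal.ofReal_le_ofReal (Real.exp_le_exp.2 ?_)
        have := totalAdvance_mono (allTokens e.2).card hsub
        gcongr
    · rw [Set.indicator_of_notMem hbad, mul_zero, add_zero, globalPotential, globalPotential,
        if_neg hS, htok]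
      split_ifs
      · exact zero_le
      · have hhalf : (1 / 2 : ℝ≥0∞) = ENNReal.ofReal (1 / 2) := by
          rw [ENNReal.ofReal_div_of_pos (by norm_num)]; simp
        rw [hhalf, ← ENNReal.ofReal_mul (Real.exp_nonneg _)]
        refine ENNReal.ofReal_le_ofReal ?_
        have hadv := totalAdvance_add_le hα0 hα1 hi hsub hbad
        have he2 : Real.exp (-1) ≤ 1 / 2 := by
          rw [Real.exp_neg, inv_eq_one_div]
          have := Real.add_one_le_exp 1
          exact one_div_le_one_div_of_le (by norm_num) (by linarith)
        refine le_trans ?_ (mul_le_mul_of_nonneg_left he2 (Real.exp_nonneg _))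
        rw [← Real.exp_add, Real.exp_le_exp, div_add' _ _ _ (by positivity)]
        gcongr
        linarith
  have hhalf' : (1 / 2 : ℝ≥0∞) + 1 / 2 * (1 / 2) = ENNReal.ofReal (3 / 4) := by
    rw [← ENNReal.toReal_eq_toReal_iff' (by finiteness) (by finiteness),
      ENNReal.toReal_add (by finiteness) (by finiteness), ENNReal.toReal_ofReal (by norm_num)]
    simp
    norm_num
  calc _ ≤ expect μ (fun e' => globalPotential α e.2 * (1 / 2) +
        globalPotential α e.2 * (1 / 2) * B.indicator 1 e') := expect_mono hpt
    _ = globalPotential α e.2 * (1 / 2) +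
        globalPotential α e.2 * (1 / 2) * expect μ (B.indicator 1) := by
        rw [expect_add, expect_const, expect_const_mul]
    _ ≤ globalPotential α e.2 * (1 / 2) + globalPotential α e.2 * (1 / 2) * (1 / 2) := by gcongr
    _ = _ := by rw [mul_assoc, ← mul_add, hhalf', mul_comm]

/-- The failure probability of gossip without hash collisions decays geometrically in the number
`P` of phases. -/
theorem expect_not_solved_le [DecidableRel G.Adj] {R : Resolution V τ} (hG : G.Connected)
    (hV : 2 ≤ Fintype.card V) (e : History V τ × TokenState V τ) {P r : ℕ}
    (hr : P * (10 * Nat.size G.maxDegree) ≤ r) :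
    expect (iterKernel (gossipRound G id R) r e)
      (Set.indicator {e' | ¬ GossipSolved e.2 e'.2} 1) ≤
      ENNReal.ofReal ((3 / 4) ^ P * Real.exp (96 * ((allTokens e.2).card / vertexExpansion G) *
        Real.log ((Fintype.card V : ℝ) + 1))) := by
  classical
  have hα0 := vertexExpansion_pos hG hV
  set t := 10 * Nat.size G.maxDegree with ht
  have hphases : ∀ P, expect (iterKernel (gossipRound G id R) (P * t) e)
      (fun e' => globalPotential (vertexExpansion G) e'.2) ≤
      ENNReal.ofReal (3 / 4) ^ P * globalPotential (vertexExpansion G) e.2 := by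
    intro P
    induction P with
    | zero => simp [iterKernel, expect_pure]
    | succ P ih =>
      rw [Nat.succ_mul, iterKernel_add, expect_bind]
      calc _ ≤ expect (iterKernel (gossipRound G id R) (P * t) e) (fun e' =>
            ENNReal.ofReal (3 / 4) * globalPotential (vertexExpansion G) e'.2) :=
            expect_mono fun e' _ => expect_globalPotential_le hG hV e'
        _ ≤ ENNReal.ofReal (3 / 4) *
            (ENNReal.ofReal (3 / 4) ^ P * globalPotential (vertexExpansion G) e.2) := by
            rw [expect_const_mul]; gcongr
        _ = _ := by rw [pow_succ]; ring
  obtain ⟨s, rfl⟩ := Nat.exists_eq_add_of_le hr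
  rw [iterKernel_add, expect_bind]
  calc _ ≤ expect (iterKernel (gossipRound G id R) (P * t) e)
        (fun e' => globalPotential (vertexExpansion G) e'.2) := by
        refine expect_mono fun y hy => ?_
        obtain ⟨-, htok⟩ := iterKernel_gossipRound_support hy
        by_cases hyS : GossipSolved y.2 y.2
        · refine (expect_le_of_support (a := 0) fun z hz => ?_).trans zero_le
          rw [Set.indicator_of_notMem]
          simp only [Set.mem_ofPred_eq, not_not]
          have := hyS.mono (iterKernel_gossipRound_support hz).1
          rwa [GossipSolved, htok] at this
        · refine le_trans (expect_le_of_support fun z _ => ?_) (one_le_globalPotential hα0 hyS)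
          exact Set.indicator_le_self' (fun _ _ => zero_le) z
    _ ≤ _ := hphases P
    _ ≤ _ := by
        rw [ENNReal.ofReal_mul (by positivity), ENNReal.ofReal_pow (by norm_num)]
        gcongr
        exact globalPotential_le hα0 e.2

end Progress

/-! ### Replacing the random hash function by an injective one -/

section Coupling

variable {V τ β : Type*} [Fintype V] {G : SimpleGraph V}

/-- The token sets that have occurred in an execution. -/
def tokenSets (e : History V τ × TokenState V τ) : Set (Finset τ) :=
  {A | ∃ S, (S = e.2 ∨ ∃ p, (S, p) ∈ e.1) ∧ ∃ v, S v = A}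

/-- The executions in which the hash function `H` separates the token sets that have occurred. -/
def collisionFree (H : Finset τ → β) : Set (History V τ × TokenState V τ) :=
  {e | Set.InjOn H (tokenSets e)}

theorem proposalDist_eq_id {H : Finset τ → β} {S : TokenState V τ}
    (h : ∀ u v, H (S u) = H (S v) → S u = S v) : proposalDist G H S = proposalDist G id S := by
  have h' : ∀ u v, H (S u) ≠ H (S v) ↔ S u ≠ S v := fun u v =>
    not_congr ⟨h u v, fun h => by rw [h]⟩
  have hcand : ∀ u, candidates G H S u = candidates G id S u := by
    intro u
    ext v
    simp only [mem_candidates, h', id]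
  have hjoint : jointChoices G H S = jointChoices G id S := by
    ext p
    simp only [mem_jointChoices]
    refine forall_congr' fun u => ?_
    rw [choices, choices, hcand u]
  unfold proposalDist
  congr 1

theorem execution_eq_iterKernel (H : Finset τ → β) (R : Resolution V τ) (T : TokenState V τ)
    (r : ℕ) : execution G H R T r = iterKernel (gossipRound G H R) r ([], T) := by
  induction r with
  | zero => rfl
  | succ r ih => rw [execution, ih]; rfl

theorem gossipRound_support_history {H : Finset τ → β} {R : Resolution V τ}
    {e e' : History V τ × TokenState V τ} (h : e' ∈ (gossipRound G H R e).support) :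
    ∃ p, e'.1 = (e.2, p) :: e.1 := by
  simp only [gossipRound, PMF.mem_support_bind_iff, PMF.mem_support_map_iff] at h
  obtain ⟨p, -, S', -, rfl⟩ := h
  exact ⟨p, rfl⟩

/-- An execution in which the hash function has separated all token sets has the same probability
as under an injective hash function. -/
theorem iterKernel_apply_eq_id {H : Finset τ → β} {R : Resolution V τ}
    (x e : History V τ × TokenState V τ) (he : e ∈ collisionFree H) (r : ℕ) :
    iterKernel (gossipRound G H R) r x e = iterKernel (gossipRound G id R) r x e := by
  induction r generalizing e with
  | zero => rfl
  | succ r ih =>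
    simp only [iterKernel, PMF.bind_apply]
    refine tsum_congr fun y => ?_
    by_cases hy : ∃ p, e.1 = (y.2, p) :: y.1
    · obtain ⟨p, hp⟩ := hy
      have hsub : tokenSets y ⊆ tokenSets e := by
        rintro A ⟨S, hS, hA⟩
        refine ⟨S, Or.inr ?_, hA⟩
        rw [hp]
        rcases hS with rfl | ⟨q, hq⟩
        · exact ⟨p, List.mem_cons_self⟩
        · exact ⟨q, List.mem_cons_of_mem _ hq⟩
      have hyH : y ∈ collisionFree H := Set.InjOn.mono hsub he
      rw [ih y hyH, gossipRound, gossipRound, proposalDist_eq_id]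
      exact fun u v huv => hyH ⟨y.2, Or.inl rfl, u, rfl⟩ ⟨y.2, Or.inl rfl, v, rfl⟩ huv
    · rw [(PMF.apply_eq_zero_iff _ _).2 fun h => hy (gossipRound_support_history h),
        (PMF.apply_eq_zero_iff _ _).2 fun h => hy (gossipRound_support_history h),
        mul_zero, mul_zero]

theorem expect_indicator_add_compl {X : Type*} (μ : PMF X) (A : Set X) :
    expect μ (A.indicator 1) + expect μ (Aᶜ.indicator 1) = 1 := by
  rw [← expect_add, ← expect_const μ 1]
  congr 1
  funext x
  by_cases hx : x ∈ A <;> simp [hx]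

/-- The failure probability under a hash function `H` exceeds that under an injective one by at
most the probability that `H` fails to separate the token sets of the latter execution. -/
theorem expect_indicator_le_id_add {H : Finset τ → β} {R : Resolution V τ}
    (x : History V τ × TokenState V τ) (r : ℕ) (A : Set (History V τ × TokenState V τ)) :
    expect (iterKernel (gossipRound G H R) r x) (A.indicator 1) ≤
      expect (iterKernel (gossipRound G id R) r x) (A.indicator 1) +
        expect (iterKernel (gossipRound G id R) r x) ((collisionFree H)ᶜ.indicator 1) := by
  set μ := iterKernel (gossipRound G H R) r x with hμ
  set ν := iterKernel (gossipRound G id R) r x with hν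
  have heq : ∀ D ⊆ collisionFree H, expect μ (D.indicator 1) = expect ν (D.indicator 1) := by
    intro D hD
    refine tsum_congr fun e => ?_
    by_cases he : e ∈ D
    · rw [hμ, hν, iterKernel_apply_eq_id x e (hD he)]
    · simp [he]
  have hcompl : expect μ ((collisionFree H)ᶜ.indicator 1) =
      expect ν ((collisionFree H)ᶜ.indicator 1) := by
    have h1 := expect_indicator_add_compl μ (collisionFree H)
    have h2 := expect_indicator_add_compl ν (collisionFree H)
    rw [heq _ subset_rfl, ← h2] at h1
    refine (ENNReal.add_right_inj ?_).1 h1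
    exact ne_top_of_le_ne_top ENNReal.one_ne_top (h2 ▸ le_self_add)
  calc _ ≤ expect μ (fun e => (A ∩ collisionFree H).indicator 1 e +
        (collisionFree H)ᶜ.indicator 1 e) := by
        refine expect_mono fun e _ => ?_
        by_cases h1 : e ∈ A <;> by_cases h2 : e ∈ collisionFree H <;> simp [h1, h2]
    _ = expect ν ((A ∩ collisionFree H).indicator 1) +
        expect ν ((collisionFree H)ᶜ.indicator 1) := by
        rw [expect_add, heq _ Set.inter_subset_right, hcompl]
    _ ≤ _ := by
        gcongr
        refine expect_mono fun e _ => ?_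
        exact Set.indicator_le_indicator_apply_of_subset Set.inter_subset_left zero_le

/-- The token sets of each node in an execution are linearly ordered by inclusion, and the current
one is the largest. -/
def IsMonotoneExecution (e : History V τ × TokenState V τ) : Prop :=
  (∀ q ∈ e.1, ∀ v, q.1 v ⊆ e.2 v) ∧
    ∀ q ∈ e.1, ∀ q' ∈ e.1, ∀ v, q.1 v ⊆ q'.1 v ∨ q'.1 v ⊆ q.1 v

theorem isMonotoneExecution_of_mem_support {H : Finset τ → β} {R : Resolution V τ}
    {x e : History V τ × TokenState V τ} (hx : IsMonotoneExecution x) {r : ℕ}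
    (he : e ∈ (iterKernel (gossipRound G H R) r x).support) : IsMonotoneExecution e := by
  refine iterKernel_support_rel (Q := fun x y => IsMonotoneExecution x → IsMonotoneExecution y)
    (fun _ h => h) (fun _ _ _ h1 h2 h => h2 (h1 h)) ?_ r x e he hx
  intro y z hz hy
  have hsub := gossipRound_support_subset hz
  simp only [gossipRound, PMF.mem_support_bind_iff, PMF.mem_support_map_iff] at hz
  obtain ⟨p, -, S', -, rfl⟩ := hz
  simp only [IsMonotoneExecution, List.mem_cons] at hy hsub ⊢
  refine ⟨?_, ?_⟩
  · rintro q (rfl | hq) v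
    · exact hsub v
    · exact (hy.1 q hq v).trans (hsub v)
  · rintro q (rfl | hq) q' (rfl | hq') v
    · exact Or.inl subset_rfl
    · exact Or.inr (hy.1 q' hq' v)
    · exact Or.inl (hy.1 q hq v)
    · exact hy.2 q hq q' hq' v

/-- In an execution with `n` nodes and `k` tokens at most `n * (k + 1)` token sets occur, since
the sets of one node are determined by their size. -/
theorem exists_finset_tokenSets {e : History V τ × TokenState V τ} (he : IsMonotoneExecution e) :
    ∃ s : Finset (Finset τ), (s : Set (Finset τ)) = tokenSets e ∧
      s.card ≤ Fintype.card V * ((allTokens e.2).card + 1) ∧ ∀ A ∈ s, A ⊆ allTokens e.2 := by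
  classical
  have hsub : ∀ A ∈ tokenSets e, A ⊆ allTokens e.2 := by
    rintro A ⟨S, hS | ⟨p, hS⟩, v, rfl⟩
    · rw [hS]; exact subset_allTokens _ _
    · exact (he.1 _ hS v).trans (subset_allTokens _ _)
  have hfin : (tokenSets e).Finite :=
    (allTokens e.2).powerset.finite_toSet.subset fun A hA => by
      simpa using hsub A hA
  refine ⟨hfin.toFinset, by simp, ?_, fun A hA => hsub A (by simpa using hA)⟩
  rcases hfin.toFinset.eq_empty_or_nonempty with hempty | ⟨A₀, hA₀⟩
  · simp [hempty]
  obtain ⟨-, -, v₀, -⟩ := hfin.mem_toFinset.1 hA₀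
  have : Nonempty V := ⟨v₀⟩
  choose! S hS v hv using fun A (hA : A ∈ tokenSets e) => hA
  have hcard : (Finset.univ ×ˢ Finset.range ((allTokens e.2).card + 1) :
      Finset (V × ℕ)).card = Fintype.card V * ((allTokens e.2).card + 1) := by
    rw [Finset.card_product, Finset.card_univ, Finset.card_range]
  rw [← hcard]
  refine Finset.card_le_card_of_injOn (fun A => (v A, A.card)) ?_ ?_
  · intro A hA
    have hA' : A ∈ tokenSets e := by simpa using hA
    simpa using Nat.lt_succ_of_le (Finset.card_le_card (hsub A hA'))
  · intro A hA B hB hAB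
    have hA' : A ∈ tokenSets e := by simpa using hA
    have hB' : B ∈ tokenSets e := by simpa using hB
    simp only [Prod.mk.injEq] at hAB
    obtain ⟨hvAB, hc⟩ := hAB
    have hcomp : S A (v A) ⊆ S B (v A) ∨ S B (v A) ⊆ S A (v A) := by
      rcases hS A hA' with h1 | ⟨p, h1⟩ <;> rcases hS B hB' with h2 | ⟨q, h2⟩
      · rw [h1, h2]; exact Or.inl subset_rfl
      · rw [h1]; exact Or.inr (he.1 _ h2 _)
      · rw [h2]; exact Or.inl (he.1 _ h1 _)
      · exact he.2 _ h1 _ h2 _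
    rw [hv A hA', hvAB, hv B hB'] at hcomp
    rcases hcomp with h | h
    · exact Finset.eq_of_subset_of_card_le h hc.ge
    · exact (Finset.eq_of_subset_of_card_le h hc.le).symm

/-- The union bound over the pairs of elements of `s`. -/
theorem toOuterMeasure_not_injOn_le {hashDist : PMF (Finset τ → β)} (s : Finset (Finset τ))
    {q : ℝ≥0∞}
    (h : ∀ A ∈ s, ∀ B ∈ s, A ≠ B → hashDist.toOuterMeasure {H | H A = H B} ≤ q) :
    hashDist.toOuterMeasure {H | ¬ Set.InjOn H (s : Set (Finset τ))} ≤ s.card.choose 2 * q := by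
  classical
  calc _ ≤ hashDist.toOuterMeasure (⋃ P ∈ s.powersetCard 2,
        {H | ∃ A ∈ P, ∃ B ∈ P, A ≠ B ∧ H A = H B}) := by
        refine MeasureTheory.measure_mono fun H hH => ?_
        simp only [Set.InjOn, Set.mem_ofPred_eq, not_forall] at hH
        obtain ⟨A, hA, B, hB, hAB, hne⟩ := hH
        simp only [Set.mem_iUnion, Set.mem_ofPred_eq]
        refine ⟨{A, B}, ?_, A, by simp, B, by simp, hne, hAB⟩
        rw [Finset.mem_powersetCard]
        refine ⟨?_, Finset.card_pair hne⟩
        intro x hx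
        rcases Finset.mem_insert.1 hx with rfl | hx
        · exact hA
        · rw [Finset.mem_singleton.1 hx]; exact hB
    _ ≤ ∑ P ∈ s.powersetCard 2, hashDist.toOuterMeasure
        {H | ∃ A ∈ P, ∃ B ∈ P, A ≠ B ∧ H A = H B} :=
        MeasureTheory.measure_biUnion_finset_le _ _
    _ ≤ ∑ P ∈ s.powersetCard 2, q := by
        refine Finset.sum_le_sum fun P hP => ?_
        obtain ⟨hPs, hP2⟩ := Finset.mem_powersetCard.1 hP
        obtain ⟨A, B, hne, rfl⟩ := Finset.card_eq_two.1 hP2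
        refine le_trans (MeasureTheory.measure_mono ?_)
          (h A (hPs (by simp)) B (hPs (by simp)) hne)
        rintro H ⟨A', hA', B', hB', hne', hH⟩
        simp only [Finset.mem_insert, Finset.mem_singleton] at hA' hB'
        rcases hA' with rfl | rfl <;> rcases hB' with rfl | rfl
        · exact absurd rfl hne'
        · exact hH
        · exact hH.symm
        · exact absurd rfl hne'
    _ = _ := by rw [Finset.sum_const, Finset.card_powersetCard, nsmul_eq_mul]

/-- A random hash function that rarely collides on any pair of token sets fails almost as rarely
as an injective one. Independence of the hash function and the execution under the injective one
reduces this to a union bound over the pairs of token sets of a fixed execution. -/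
theorem toOuterMeasure_randomDiffusionGossip_le {hashDist : PMF (Finset τ → β)}
    {R : Resolution V τ} {T : TokenState V τ} {r : ℕ} {q : ℝ≥0∞}
    (hq : ∀ A B : Finset τ, A ⊆ allTokens T → B ⊆ allTokens T → A ≠ B →
      hashDist.toOuterMeasure {H | H A = H B} ≤ q) (hT : ∀ e ∈
        (iterKernel (gossipRound G id R) r ([], T)).support, allTokens e.2 = allTokens T)
    (A : Set (History V τ × TokenState V τ)) :
    (randomDiffusionGossip G hashDist R T r).toOuterMeasure A ≤
      expect (iterKernel (gossipRound G id R) r ([], T)) (A.indicator 1) +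
        (Fintype.card V * ((allTokens T).card + 1)).choose 2 * q := by
  classical
  rw [toOuterMeasure_eq_expect, randomDiffusionGossip, expect_bind]
  simp only [execution_eq_iterKernel]
  refine (expect_mono fun H _ => expect_indicator_le_id_add ([], T) r A).trans ?_
  rw [expect_add, expect_const]
  gcongr
  set ν := iterKernel (gossipRound G id R) r ([], T) with hν
  have hswap : expect hashDist (fun H => expect ν ((collisionFree H)ᶜ.indicator 1)) =
      expect ν (fun e => hashDist.toOuterMeasure {H | e ∉ collisionFree H}) := by
    simp only [toOuterMeasure_eq_expect, expect, ← ENNReal.tsum_mul_left]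
    rw [ENNReal.tsum_comm]
    refine tsum_congr fun e => tsum_congr fun H => ?_
    by_cases he : e ∈ collisionFree H
    · simp [he]
    · simp [he, mul_comm]
  rw [hswap]
  refine expect_le_of_support fun e he => ?_
  have hmono : IsMonotoneExecution e :=
    isMonotoneExecution_of_mem_support (by simp [IsMonotoneExecution]) he
  obtain ⟨s, hs, hcard, hsub⟩ := exists_finset_tokenSets hmono
  rw [hT e he] at hcard hsub
  simp only [collisionFree, Set.mem_ofPred_eq, ← hs]
  refine (toOuterMeasure_not_injOn_le s fun A hA B hB => hq A B (hsub A hA) (hsub B hB)).trans ?_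
  gcongr

end Coupling

/-! ### The number of rounds -/

theorem size_le_log_sq {d : ℕ} (hd : 2 ≤ d) : (Nat.size d : ℝ) ≤ 5 * Real.log d ^ 2 := by
  have hl := Real.log_two_gt_d9
  have h1 : 1 < Nat.size d := Nat.lt_size.2 (by simpa using hd)
  obtain ⟨s, hs⟩ : ∃ s, Nat.size d = s + 1 := ⟨Nat.size d - 1, by omega⟩
  have h2 : 2 ^ s ≤ d := Nat.lt_size.1 (by omega)
  have h3 : (s : ℝ) * Real.log 2 ≤ Real.log d := by
    rw [← Real.log_pow]
    exact Real.log_le_log (by positivity) (by exact_mod_cast h2)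
  have h4 : (1 : ℝ) ≤ s := by exact_mod_cast (by omega : 1 ≤ s)
  rw [hs]
  push_cast
  have h5 : (0.69 : ℝ) * s ≤ Real.log d := by nlinarith
  nlinarith

/-- The number of phases that fit into the rounds makes the failure probability without hash
collisions at most half of the allowed one. -/
theorem exists_phases {c α L : ℝ} {n k d r : ℕ} (hc : 0 < c) (hα0 : 0 < α) (hα1 : α ≤ 1)
    (hn : 2 ≤ n) (hk : 1 ≤ k) (hd : 1 ≤ d) (hL : (d : ℝ) ≤ 50 * L)
    (hr : 50 * (4 * (193 + c) + 2) * (k / α) * Real.log n * L ≤ r) :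
    ∃ P : ℕ, P * d ≤ r ∧
      (3 / 4 : ℝ) ^ P * Real.exp (96 * (k / α) * Real.log (n + 1)) ≤ (n : ℝ) ^ (-c) / 2 := by
  have hnR : (2 : ℝ) ≤ n := by exact_mod_cast hn
  have hkR : (1 : ℝ) ≤ k := by exact_mod_cast hk
  have hdR : (1 : ℝ) ≤ d := by exact_mod_cast hd
  have hl2 := Real.log_two_gt_d9
  have hlogn : Real.log 2 ≤ Real.log n := Real.log_le_log (by norm_num) hnR
  have hka : 1 ≤ (k : ℝ) / α := by rw [le_div_iff₀ hα0]; linarith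
  set Y := (k : ℝ) / α * Real.log n with hY
  have hlogY : Real.log n ≤ Y := by
    rw [hY]; exact le_mul_of_one_le_left (by linarith) hka
  have hP : 4 * (193 + c) * Y ≤ ((r / d : ℕ) : ℝ) := by
    have h1 : r < (r / d + 1) * d := by
      rw [mul_comm]; exact Nat.lt_mul_div_succ r hd
    have h2 : (r : ℝ) < ((r / d : ℕ) + 1) * d := by exact_mod_cast h1
    have hM : (0 : ℝ) ≤ (4 * (193 + c) + 2) * Y := by
      have : 0 ≤ Y := by linarith
      positivity
    have h3 : (4 * (193 + c) + 2) * Y * d ≤ (4 * (193 + c) + 2) * Y * (50 * L) :=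
      mul_le_mul_of_nonneg_left hL hM
    have h4 : (4 * (193 + c) + 2) * Y * (50 * L) =
        50 * (4 * (193 + c) + 2) * (k / α) * Real.log n * L := by rw [hY]; ring
    have h5 : (4 * (193 + c) + 2) * Y * d < ((r / d : ℕ) + 1) * d := by linarith
    have h6 := lt_of_mul_lt_mul_right h5 (by linarith)
    linarith
  refine ⟨r / d, Nat.div_mul_le_self r d, ?_⟩
  have h34 : (3 / 4 : ℝ) ≤ Real.exp (-(1 / 4)) := by
    have := Real.add_one_le_exp (-(1 / 4) : ℝ)
    linarith
  have hlog1 : Real.log (n + 1) ≤ 2 * Real.log n := by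
    rw [← Real.log_rpow (by linarith) 2]
    refine Real.log_le_log (by linarith) ?_
    norm_num
    nlinarith
  have hgoal : (n : ℝ) ^ (-c) / 2 = Real.exp (-(c * Real.log n) - Real.log 2) := by
    rw [Real.exp_sub, Real.exp_log (by norm_num), Real.rpow_def_of_pos (by linarith)]
    congr 2
    ring
  rw [hgoal]
  calc _ ≤ Real.exp (-(1 / 4)) ^ (r / d) * Real.exp (96 * (k / α) * Real.log (n + 1)) := by
        gcongr
    _ = Real.exp (-((r / d : ℕ) : ℝ) / 4 + 96 * (k / α) * Real.log (n + 1)) := by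
        rw [← Real.exp_nat_mul, ← Real.exp_add]
        congr 1
        ring
    _ ≤ _ := by
        rw [Real.exp_le_exp]
        have h1 : 96 * ((k : ℝ) / α) * Real.log (n + 1) ≤ 192 * Y := by
          have := mul_le_mul_of_nonneg_left hlog1 (by positivity : 0 ≤ 96 * ((k : ℝ) / α))
          rw [hY]
          linarith
        have h2 : c * Real.log n ≤ c * Y := mul_le_mul_of_nonneg_left hlogY hc.le
        linarith

/-- The union bound over pairs of token sets costs at most half of the allowed failure
probability. -/
theorem choose_two_mul_le {N : ℕ} {a b : ℝ} (ha : 0 ≤ a) (hb : 0 < b) (hN : (N : ℝ) = b) :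
    (N.choose 2 : ℝ≥0∞) * ENNReal.ofReal (a / b ^ 2) ≤ ENNReal.ofReal (a / 2) := by
  rw [← ENNReal.ofReal_natCast, ← ENNReal.ofReal_mul (by positivity)]
  refine ENNReal.ofReal_le_ofReal ?_
  rw [Nat.cast_choose_two, hN, mul_div_assoc', div_le_div_iff₀ (by positivity) (by norm_num)]
  nlinarith [mul_nonneg ha hb.le]

theorem two_le_maxDegree {V : Type*} [Fintype V] {G : SimpleGraph V} [DecidableRel G.Adj]
    (hG : G.Connected) (hV : 3 ≤ Fintype.card V) : 2 ≤ G.maxDegree := by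
  classical
  obtain ⟨a⟩ := hG.nonempty
  obtain ⟨u, hu, b, hb, hub⟩ := exists_adj_notMem_of_connected hG (S := {a}) (by simp)
    (by rw [Finset.card_singleton]; omega)
  rw [Finset.mem_singleton] at hu hb
  subst hu
  have hab : ({u, b} : Finset V).card = 2 := Finset.card_pair (Ne.symm hb)
  obtain ⟨x, hx, y, hy, hxy⟩ := exists_adj_notMem_of_connected hG (S := {u, b}) (by simp)
    (by omega)
  have key : ∀ x z y : V, G.Adj x z → G.Adj x y → z ≠ y → 2 ≤ G.maxDegree := by
    intro x z y hz hy hne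
    refine le_trans ?_ (G.degree_le_maxDegree x)
    rw [← Finset.card_pair hne]
    refine Finset.card_le_card fun w hw => (G.mem_neighborFinset x w).2 ?_
    rcases Finset.mem_insert.1 hw with rfl | hw
    · exact hz
    · rw [Finset.mem_singleton.1 hw]; exact hy
  simp only [Finset.mem_insert, Finset.mem_singleton, not_or] at hx hy
  rcases hx with rfl | rfl
  · exact key x b y hub hxy (Ne.symm hy.2)
  · exact key x u y hub.symm hxy (Ne.symm hy.1)

end MobileTelephone

theorem mainTheorem1 (c : ℝ) (hc : 0 < c) :
    ∃ C : ℝ, 0 < C ∧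
      ∀ (V τ β : Type*) [Fintype V] (G : SimpleGraph V) [DecidableRel G.Adj]
        (hashDist : PMF (Finset τ → β)) (R : MobileTelephone.Resolution V τ)
        (T : MobileTelephone.TokenState V τ) (n k : ℕ),
        Fintype.card V = n → 3 ≤ n → G.Connected →
        (MobileTelephone.allTokens T).card = k →
        (∀ A B : Finset τ, A ⊆ MobileTelephone.allTokens T →
          B ⊆ MobileTelephone.allTokens T → A ≠ B →
          hashDist.toOuterMeasure {H | H A = H B} ≤
            ENNReal.ofReal ((n : ℝ) ^ (-c) / ((n : ℝ) * ((k : ℝ) + 1)) ^ 2)) →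
        ∀ r : ℕ,
          C * ((k : ℝ) / MobileTelephone.vertexExpansion G) * Real.log (n : ℝ) *
              Real.log (G.maxDegree : ℝ) ^ 2 ≤ (r : ℝ) →
          (MobileTelephone.randomDiffusionGossip G hashDist R T r).toOuterMeasure
              {e | ¬ MobileTelephone.GossipSolved T e.2} ≤
            ENNReal.ofReal ((n : ℝ) ^ (-c)) := by
  refine ⟨50 * (4 * (193 + c) + 2), by positivity, ?_⟩
  intro V τ β _ G _ hashDist R T n k hV hn hG hk hcoll r hr
  subst hV
  have hα0 := MobileTelephone.vertexExpansion_pos hG (by omega)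
  have hα1 := MobileTelephone.vertexExpansion_le_one (G := G) (by omega)
  rcases Nat.eq_zero_or_pos k with rfl | hkpos
  · have hempty : {e : MobileTelephone.History V τ × MobileTelephone.TokenState V τ |
        ¬ MobileTelephone.GossipSolved T e.2} = ∅ := by
      ext e
      simp [MobileTelephone.GossipSolved, Finset.card_eq_zero.1 hk]
    rw [hempty]
    simp
  have hdeg := MobileTelephone.two_le_maxDegree hG hn
  have hd := MobileTelephone.size_le_log_sq hdeg
  have hsize : 1 ≤ 10 * Nat.size G.maxDegree := by
    have : 0 < Nat.size G.maxDegree := Nat.lt_size.2 (by omega)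
    omega
  obtain ⟨P, hP, hfail⟩ := MobileTelephone.exists_phases (d := 10 * Nat.size G.maxDegree)
    (L := Real.log (G.maxDegree : ℝ) ^ 2) hc hα0 hα1 (by omega) hkpos hsize
    (by push_cast; linarith) hr
  have hnc : (0 : ℝ) ≤ (Fintype.card V : ℝ) ^ (-c) := by positivity
  refine (MobileTelephone.toOuterMeasure_randomDiffusionGossip_le hcoll
    (fun e he => (MobileTelephone.iterKernel_gossipRound_support he).2) _).trans ?_
  calc _ ≤ ENNReal.ofReal ((Fintype.card V : ℝ) ^ (-c) / 2) +
        ENNReal.ofReal ((Fintype.card V : ℝ) ^ (-c) / 2) := by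
        refine add_le_add ?_ ?_
        · refine (MobileTelephone.expect_not_solved_le hG (by omega) ([], T) hP).trans ?_
          rw [hk]
          exact ENNReal.ofReal_le_ofReal hfail
        · exact MobileTelephone.choose_two_mul_le hnc (by positivity) (by rw [hk]; push_cast; rfl)
    _ = _ := by
        rw [← ENNReal.ofReal_add (by positivity) (by positivity), add_halves]
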